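/- Let $\Omega\subset\mathbb R^d$, $d\in\{2,3\}$, be a bounded polygonal (polyhedral) domain with Lipschitz boundary, and let $\partial\Omega_D,\partial\Omega_N$ be disjoint relatively open subsets of $\partial\Omega$ with $\overline{\partial\Omega_D}\cup\overline{\partial\Omega_N}=\partial\Omega$. Let $A\in L^\infty(\Omega)^{d\times d}$ be symmetric with $\alpha|\xi|^2\le A\xi\cdot\xi\le\beta|\xi|^2$ for all $\xi\in\mathbb R^d$ a.e. in $\Omega$ ($0<\alpha<\beta$), and let $f\in L^2(\Omega)$, $g\in H^{-1/2}(\partial\Omega_N)$, $q\in H^{1/2}(\partial\Omega_D)$. For open $\omega\subset\Omega$ put $$a_\omega(u,v)=\int_\omega A\nabla u\cdot\nabla v\,dx,\quad F_\omega(v)=\int_{\partial\omega\cap\partial\Omega_N}gv\,ds+\int_\omega fv\,dx,\quad \|u\|_{a,\omega}=a_\omega(u,u)^{1/2},$$ and drop the index if $\omega=\Omega$. Let $u^e\in H^1(\Omega)$, $u^e=q$ on $\partial\Omega_D$, satisfy $a(u^e,v)=F(v)$ for all $v\in H^1(\Omega)$ with $v=0$ on $\partial\Omega_D$. Let $V_h\subset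 H^1(\Omega)$ be the lowest-order Lagrange finite element space on a conforming triangulation of $\Omega$ into simplices (or into axis-parallel boxes if $\Omega$ is a box), and let $u_h^e\in V_h$, $u_h^e=q$ on $\partial\Omega_D$, satisfy $a(u_h^e,v)=F(v)$ for all $v\in V_h$ with $v=0$ on $\partial\Omega_D$. Let $\omega_1,\dots,\omega_M$ be open sets with $\bigcup_i\omega_i=\Omega$, let $\omega_i^*$ be connected open sets resolved by the mesh with $\omega_i\subset\omega_i^*\subset\Omega$, and suppose that each $x\in\Omega$ lies in at most $\kappa$ of the $\omega_i$ and in at most $\kappa^*$ of the $\omega_i^*$. Let $\chi_1,\dots,\chi_M$ satisfy $0\le\chi_i\le1$ and $\sum_i\chi_i=1$ on $\Omega$, $\chi_i=0$ on $\Omega\setminus\omega_i$, $\chi_i\in C^1(\omega_i)$ and $|\nabla\chi_i|\le C_1/\operatorname{diam}(\omega_i)$ on $\omega_i$. For each $i$ let $V_h(\omega_i^*)=\{v|_{\omega_i^*}:v\in V_h\}$ and - $V_{h,D}(\omega_i^*)=\{v\in V_h(\omega_i^*):v=0\text{ on }\partial\omega_i^*\cap\partial\Omega_D\}$, - $V_{h,DI}(\omega_i^*)=\{v\in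 V_h(\omega_i^*):v=0\text{ on }(\partial\omega_i^*\cap\partial\Omega_D)\cup(\partial\omega_i^*\cap\Omega)\}$, - $W_h(\omega_i^*)=\{u\in V_{h,D}(\omega_i^*):a_{\omega_i^*}(u,v)=0\ \ \forall v\in V_{h,DI}(\omega_i^*)\}$. Let $\psi_{h,i}=\psi_{h,i}^r+\psi_{h,i}^d$, where $\psi_{h,i}^r\in V_{h,DI}(\omega_i^*)$ satisfies $a_{\omega_i^*}(\psi_{h,i}^r,v)=F_{\omega_i^*}(v)$ for all $v\in V_{h,DI}(\omega_i^*)$, and $\psi_{h,i}^d\in V_h(\omega_i^*)$ satisfies $\psi^d_{h,i}=q$ on $\partial\omega_i^*\cap\partial\Omega_D$ and $a_{\omega_i^*}(\psi_{h,i}^d,v)=0$ for all $v\in V_{h,D}(\omega_i^*)$. Let $(\lambda_{h,k},\phi_{h,k})$, $k=1,\dots,\dim W_h(\omega_i^*)$, be the eigenpairs of $$a_{\omega_i^*}(\phi_h,v)=\lambda_h\,a_{\omega_i}(\chi_i\phi_h,\chi_iv)\qquad\forall v\in W_h(\omega_i^*)$$ (for subdomain $i$) with $\lambda_{h,1}\le\lambda_{h,2}\le\cdots$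 and $(\phi_{h,k})_k$ a basis of $W_h(\omega_i^*)$; here $\lambda_{h,k}=\infty$ is allowed and means $a_{\omega_i}(\chi_i\phi_{h,k},\chi_iv)=0$ for all $v\in W_h(\omega_i^*)$, and $\lambda_{h,k}:=\infty$ for $k>\dim W_h(\omega_i^*)$. Let $0\le n_i\le\dim W_h(\omega_i^*)$, with $n_i\ge1$ if $\partial\omega_i^*\cap\partial\Omega_D=\emptyset$, and put $$u_h^p=\sum_{i=1}^M\chi_i\,\psi_{h,i}|_{\omega_i},\qquad S_h(\Omega)=\Big\{\sum_{i=1}^M\chi_iv_i:\ v_i\in\operatorname{span}\{\phi_{h,1}|_{\omega_i},\dots,\phi_{h,n_i}|_{\omega_i}\}\Big\}.$$ Let $u_h^G=u_h^p+u_h^s$, $u_h^s\in S_h(\Omega)$, be the discrete MS-GFEM approximation: $a(u_h^s,v)=F(v)-a(u_h^p,v)$ for all $v\in S_h(\Omega)$. **Theorem.** $u_h^G\in H^1(\Omega)$ and $$\|u^e-u_h^G\|_a\le\|u^e-u_h^e\|_a+\sqrt{\kappa\kappa^*}\,\Big(\max_{i=1,\dots,M}\lambda_{h,n_i+1}^{-1/2}\Big)\|u_h^e\|_a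 ,$$ where $\lambda_{h,n_i+1}$ is the $(n_i+1)$-th eigenvalue for the $i$-th subdomain and $\infty^{-1/2}=0$. -/

import Mathlib

open Set Filter Topology MeasureTheory
open scoped ENNReal

noncomputable section

namespace MSGFEM

/-- The Euclidean space `ℝᵈ`. -/
abbrev E (d : ℕ) : Type := EuclideanSpace ℝ (Fin d)

/-! ### Domains -/

/-- A bounded domain (nonempty, open, connected) with Lipschitz boundary: near each boundary point
`x` the set is the part above the graph of a Lipschitz function `γ`, in a coordinate system whose
last axis is the unit vector `e`; that `γ` is a function of the other coordinates only is expressed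
by its invariance under translations along `e`. -/
structure IsLipschitzDomain {d : ℕ} (Ω : Set (E d)) : Prop where
  isOpen : IsOpen Ω
  isConnected : IsConnected Ω
  isBounded : Bornology.IsBounded Ω
  lipschitz_boundary : ∀ x ∈ frontier Ω, ∃ (e : E d) (L : NNReal) (γ : E d → ℝ) (r : ℝ),
    ‖e‖ = 1 ∧ LipschitzWith L γ ∧ (∀ (y : E d) (t : ℝ), γ (y + t • e) = γ y) ∧ 0 < r ∧
      ∀ y ∈ Metric.ball x r, (y ∈ Ω ↔ γ y < inner ℝ e y)

/-- `Γ` is a relatively open part of the boundary of `Ω`. -/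
def IsBoundaryPart {d : ℕ} (Ω Γ : Set (E d)) : Prop :=
  ∃ U : Set (E d), IsOpen U ∧ Γ = U ∩ frontier Ω

/-! ### The Sobolev space `H¹` and traces

Functions on an open set `ω` are represented by functions `ℝᵈ → ℝ`; only the values on `ω` matter
for the notions of this part. -/

/-- `G` is the weak gradient of `u` on `ω`, tested with smooth functions compactly supported
in `ω`. -/
def HasWeakGrad {d : ℕ} (ω : Set (E d)) (u : E d → ℝ) (G : E d → E d) : Prop :=
  ∀ φ : E d → ℝ, ContDiff ℝ (⊤ : ℕ∞) φ → HasCompactSupport φ → tsupport φ ⊆ ω → ∀ e : E d,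
    ∫ x in ω, u x * fderiv ℝ φ x e = -∫ x in ω, φ x * inner ℝ (G x) e

/-- The Sobolev space `H¹(ω)`: square integrable functions with a square integrable weak
gradient. -/
def H1 {d : ℕ} (ω : Set (E d)) : Set (E d → ℝ) :=
  {u | MemLp u 2 (volume.restrict ω) ∧
    ∃ G : E d → E d, MemLp G 2 (volume.restrict ω) ∧ HasWeakGrad ω u G}

open Classical in
/-- The weak gradient `∇u` of `u ∈ H¹(ω)`, unique up to null sets (and `0` if there is none). -/
def weakGrad {d : ℕ} (ω : Set (E d)) (u : E d → ℝ) : E d → E d :=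
  if h : ∃ G : E d → E d, MemLp G 2 (volume.restrict ω) ∧ HasWeakGrad ω u G then h.choose else 0

/-- The norm of `H¹(ω)`. -/
def h1Norm {d : ℕ} (ω : Set (E d)) (u : E d → ℝ) : ℝ :=
  Real.sqrt ((∫ x in ω, u x ^ 2) + ∫ x in ω, ‖weakGrad ω u x‖ ^ 2)

/-- `u ∈ H¹(Ω)` has trace `q` on the relatively open part `Γ` of `∂Ω`. The trace on `Γ` is the
continuous extension to `H¹(Ω)` of the restriction `w ↦ w|_Γ`, defined for the functions in `H¹(Ω)`
that are continuous up to `Γ`, with values in `L²(Γ)` for the surface measure, i.e. the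
`(d - 1)`-dimensional Hausdorff measure. -/
def HasTrace {d : ℕ} (Ω Γ : Set (E d)) (u q : E d → ℝ) : Prop :=
  u ∈ H1 Ω ∧ ∃ w : ℕ → E d → ℝ,
    (∀ n, w n ∈ H1 Ω ∧ ContinuousOn (w n) (Ω ∪ Γ)) ∧
    Tendsto (fun n => h1Norm Ω (w n - u)) atTop (𝓝 0) ∧
    Tendsto (fun n => eLpNorm (w n - q) 2
      ((Measure.hausdorffMeasure ((d : ℝ) - 1)).restrict Γ)) atTop (𝓝 0)

/-- The functions in `H¹(Ω)` with zero trace on `Γ`. -/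
def H1Zero {d : ℕ} (Ω Γ : Set (E d)) : Set (E d → ℝ) := {v | HasTrace Ω Γ v 0}

/-- `g ∈ H^{-1/2}(Γ)`, the dual space of the space `H^{1/2}(Γ)` of traces on `Γ` of functions in
`H¹(Ω)` with the quotient norm: `g v`, which stands for `∫_Γ g v ds`, is linear and bounded in
`v ∈ H¹(Ω)` and depends on the trace of `v` on `Γ` only. -/
structure IsNeumannDatum {d : ℕ} (Ω Γ : Set (E d)) (g : (E d → ℝ) → ℝ) : Prop where
  map_add : ∀ u ∈ H1 Ω, ∀ v ∈ H1 Ω, g (u + v) = g u + g v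
  map_smul : ∀ c : ℝ, ∀ u ∈ H1 Ω, g (c • u) = c * g u
  bound : ∃ C : ℝ, ∀ u ∈ H1 Ω, |g u| ≤ C * h1Norm Ω u
  trace_only : ∀ u ∈ H1Zero Ω Γ, g u = 0

/-! ### The elliptic problem -/

/-- Measurable, symmetric and uniformly elliptic coefficient matrices (bounded, as
`A ξ · ξ ≤ β |ξ|²`). -/
structure IsCoefficient {d : ℕ} (Ω : Set (E d)) (A : E d → Matrix (Fin d) (Fin d) ℝ)
    (α β : ℝ) : Prop where
  aemeasurable : ∀ i j, AEMeasurable (fun x => A x i j) (volume.restrict Ω)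
  symm : ∀ᵐ x ∂volume.restrict Ω, (A x).IsSymm
  alpha_pos : 0 < α
  alpha_lt_beta : α < β
  elliptic : ∀ᵐ x ∂volume.restrict Ω, ∀ ξ : E d,
    α * ‖ξ‖ ^ 2 ≤ (A x).mulVec ξ.ofLp ⬝ᵥ ξ.ofLp ∧ (A x).mulVec ξ.ofLp ⬝ᵥ ξ.ofLp ≤ β * ‖ξ‖ ^ 2

/-- `a_ω(u, v) = ∫_ω A ∇u · ∇v dx`. -/
def energy {d : ℕ} (A : E d → Matrix (Fin d) (Fin d) ℝ) (ω : Set (E d)) (u v : E d → ℝ) : ℝ :=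
  ∫ x in ω, (A x).mulVec (weakGrad ω u x).ofLp ⬝ᵥ (weakGrad ω v x).ofLp

/-- `‖u‖_{a,ω} = √(a_ω(u, u))`. -/
def energyNorm {d : ℕ} (A : E d → Matrix (Fin d) (Fin d) ℝ) (ω : Set (E d)) (u : E d → ℝ) : ℝ :=
  Real.sqrt (energy A ω u u)

/-- `F_ω(v) = ∫_{∂ω ∩ ∂Ω_N} g v ds + ∫_ω f v dx`, for functions `v` that vanish outside `ω` and on
`∂ω ∩ Ω` (no condition if `ω = Ω`): the duality pairing is that of `g` with the trace on `∂Ω_N` of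
the extension of `v` by zero. -/
def load {d : ℕ} (f : E d → ℝ) (g : (E d → ℝ) → ℝ) (ω : Set (E d)) (v : E d → ℝ) : ℝ :=
  g v + ∫ x in ω, f x * v x

/-- `u ∈ H¹(Ω)` is the weak solution of `-div (A ∇u) = f` in `Ω`, `n · A ∇u = g` on `∂Ω_N`, `u = q`
on `ΓD = ∂Ω_D`. The trace condition contains `q ∈ H^{1/2}(∂Ω_D)`. -/
structure IsWeakSolution {d : ℕ} (Ω ΓD : Set (E d)) (A : E d → Matrix (Fin d) (Fin d) ℝ)
    (f : E d → ℝ) (g : (E d → ℝ) → ℝ) (q : E d → ℝ) (u : E d → ℝ) : Prop where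
  trace : HasTrace Ω ΓD u q
  weak : ∀ v ∈ H1Zero Ω ΓD, energy A Ω u v = load f g Ω v

/-! ### Meshes and the fine finite element space -/

/-- Mesh elements: triangles (tetrahedra), given by their vertices, and axis-parallel rectangles
(boxes), given by two opposite corners. -/
inductive Element (d : ℕ) : Type
  | simplex (vertices : Finset (E d)) : Element d
  | box (lo hi : E d) : Element d

/-- The closed point set of an element. -/
def Element.carrier {d : ℕ} : Element d → Set (E d)
  | .simplex s => convexHull ℝ (s : Set (E d))
  | .box lo hi => {x | ∀ j, lo j ≤ x j ∧ x j ≤ hi j}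

/-- The element has nonempty interior. -/
def Element.Nondegenerate {d : ℕ} : Element d → Prop
  | .simplex s => s.card = d + 1 ∧ AffineIndependent ℝ ((↑) : s → E d)
  | .box lo hi => ∀ j, lo j < hi j

/-- The two elements are of the same type and are disjoint or meet in a common face. -/
def Element.Conforming {d : ℕ} : Element d → Element d → Prop
  | .simplex s, .simplex t =>
      convexHull ℝ (s : Set (E d)) ∩ convexHull ℝ (t : Set (E d)) =
        convexHull ℝ ((s : Set (E d)) ∩ (t : Set (E d)))
  | .box lo hi, .box lo' hi' =>
      (Element.box lo hi).carrier ∩ (Element.box lo' hi').carrier = ∅ ∨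
        ∀ j, (lo j = lo' j ∧ hi j = hi' j) ∨ hi j = lo' j ∨ hi' j = lo j
  | _, _ => False

/-- The shape functions of lowest order: affine functions on a simplex, functions that are affine
in each variable on a box. -/
def Element.IsShapeFunction {d : ℕ} : Element d → (E d → ℝ) → Prop
  | .simplex _, p => ∃ (c : ℝ) (b : E d), ∀ x, p x = c + inner ℝ b x
  | .box _ _, p => ∃ c : Finset (Fin d) → ℝ, ∀ x, p x = ∑ S, c S * ∏ j ∈ S, x j

/-- A triangulation of `Ω` into triangles (tetrahedra), or into rectangles (boxes) if `Ω` is a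
rectangular domain. As the elements cover the closure of `Ω`, the set `Ω` is polygonal
(polyhedral). -/
structure IsMesh {d : ℕ} (Ω : Set (E d)) (T : Set (Element d)) : Prop where
  finite : T.Finite
  nondegenerate : ∀ K ∈ T, K.Nondegenerate
  conforming : ∀ K ∈ T, ∀ K' ∈ T, K.Conforming K'
  cover : ⋃ K ∈ T, K.carrier = closure Ω
  rectangular : ∀ lo hi : E d, Element.box lo hi ∈ T →
    ∃ a b : E d, Ω = {x | ∀ j, a j < x j ∧ x j < b j}

/-- The mesh resolves `ω`: up to element boundaries, `ω` is a union of elements. -/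
def Resolves {d : ℕ} (T : Set (Element d)) (ω : Set (E d)) : Prop :=
  ∀ K ∈ T, interior K.carrier ⊆ ω ∨ Disjoint K.carrier ω

/-- The Lagrange finite element space `V_h` of lowest order on the mesh: continuous functions on `Ω`
that are piecewise shape functions, represented by `0` outside `Ω`. -/
def Vh {d : ℕ} (Ω : Set (E d)) (T : Set (Element d)) : Set (E d → ℝ) :=
  {v | ContinuousOn v Ω ∧ (∀ x, x ∉ Ω → v x = 0) ∧
    ∀ K ∈ T, ∃ p : E d → ℝ, K.IsShapeFunction p ∧ EqOn v p (K.carrier ∩ Ω)}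

/-- `V_h(ω)`: the restrictions to `ω` of the functions in `V_h`, represented by `0` outside `ω`. -/
def VhOn {d : ℕ} (Ω : Set (E d)) (T : Set (Element d)) (ω : Set (E d)) : Set (E d → ℝ) :=
  {v | ∃ w ∈ Vh Ω T, v = ω.indicator w}

/-- `v = q` on the part `Γ` of `∂ω`, for a function `v` on `ω` that is continuous up to the
boundary (as finite element functions are): the boundary value is the limit from inside `ω`. -/
def BoundaryEq {d : ℕ} (ω Γ : Set (E d)) (v q : E d → ℝ) : Prop :=
  ∀ x ∈ Γ, Tendsto v (𝓝[ω] x) (𝓝 (q x))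

/-- `V_{h,D}(ω)`: functions in `V_h(ω)` that vanish on `∂ω ∩ ∂Ω_D`. -/
def VhD {d : ℕ} (Ω ΓD : Set (E d)) (T : Set (Element d)) (ω : Set (E d)) : Set (E d → ℝ) :=
  {v | v ∈ VhOn Ω T ω ∧ BoundaryEq ω (frontier ω ∩ ΓD) v 0}

/-- `V_{h,DI}(ω)`: functions in `V_h(ω)` that vanish on `(∂ω ∩ ∂Ω_D) ∪ (∂ω ∩ Ω)`. -/
def VhDI {d : ℕ} (Ω ΓD : Set (E d)) (T : Set (Element d)) (ω : Set (E d)) : Set (E d → ℝ) :=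
  {v | v ∈ VhOn Ω T ω ∧ BoundaryEq ω ((frontier ω ∩ ΓD) ∪ (frontier ω ∩ Ω)) v 0}

/-- The space `W_h(ω)` of discrete `A`-harmonic functions. -/
def Wh {d : ℕ} (Ω ΓD : Set (E d)) (A : E d → Matrix (Fin d) (Fin d) ℝ) (T : Set (Element d))
    (ω : Set (E d)) : Set (E d → ℝ) :=
  {u | u ∈ VhD Ω ΓD T ω ∧ ∀ v ∈ VhDI Ω ΓD T ω, energy A ω u v = 0}

/-- The fine-scale finite element solution: `u ∈ V_h`, `u = q` on `∂Ω_D`, and `a(u, v) = F(v)` for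
all `v ∈ V_h` with `v = 0` on `∂Ω_D`. -/
structure IsFineSolution {d : ℕ} (Ω ΓD : Set (E d)) (A : E d → Matrix (Fin d) (Fin d) ℝ)
    (f : E d → ℝ) (g : (E d → ℝ) → ℝ) (q : E d → ℝ) (T : Set (Element d)) (u : E d → ℝ) :
    Prop where
  mem : u ∈ Vh Ω T
  boundary : BoundaryEq Ω ΓD u q
  weak : ∀ v ∈ Vh Ω T, BoundaryEq Ω ΓD v 0 → energy A Ω u v = load f g Ω v

/-! ### The discrete MS-GFEM -/

/-- Subdomains `ω i` covering `Ω`, oversampling domains `ωs i`, and a partition of unity `χ i`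
subordinate to the `ω i`. -/
structure IsDecomposition {d M : ℕ} (Ω : Set (E d)) (ω ωs : Fin M → Set (E d))
    (χ : Fin M → E d → ℝ) (C₁ : ℝ) : Prop where
  isOpen : ∀ i, IsOpen (ω i)
  cover : ⋃ i, ω i = Ω
  isOpen_over : ∀ i, IsOpen (ωs i)
  isConnected_over : ∀ i, IsConnected (ωs i)
  subset_over : ∀ i, ω i ⊆ ωs i
  over_subset : ∀ i, ωs i ⊆ Ω
  range : ∀ i, ∀ x ∈ Ω, 0 ≤ χ i x ∧ χ i x ≤ 1
  sum_eq_one : ∀ x ∈ Ω, ∑ i, χ i x = 1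
  eq_zero : ∀ i, ∀ x ∈ Ω \ ω i, χ i x = 0
  contDiffOn : ∀ i, ContDiffOn ℝ 1 (χ i) (ω i)
  grad_bound : ∀ i, ∀ x ∈ ω i, ‖fderiv ℝ (χ i) x‖ ≤ C₁ / Metric.diam (ω i)

/-- The first part `ψʳ` of the local particular function. -/
structure IsLocalRhsPart {d : ℕ} (Ω ΓD : Set (E d)) (A : E d → Matrix (Fin d) (Fin d) ℝ)
    (f : E d → ℝ) (g : (E d → ℝ) → ℝ) (T : Set (Element d)) (ω : Set (E d)) (ψ : E d → ℝ) :
    Prop where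
  mem : ψ ∈ VhDI Ω ΓD T ω
  weak : ∀ v ∈ VhDI Ω ΓD T ω, energy A ω ψ v = load f g ω v

/-- The second part `ψᵈ` of the local particular function. -/
structure IsLocalDirichletPart {d : ℕ} (Ω ΓD : Set (E d))
    (A : E d → Matrix (Fin d) (Fin d) ℝ) (q : E d → ℝ) (T : Set (Element d)) (ω : Set (E d))
    (ψ : E d → ℝ) : Prop where
  mem : ψ ∈ VhOn Ω T ω
  boundary : BoundaryEq ω (frontier ω ∩ ΓD) ψ q
  weak : ∀ v ∈ VhD Ω ΓD T ω, energy A ω ψ v = 0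

/-- The eigenpairs `(lam k, φ k)` of the problem `a_{ωs}(φ, v) = λ a_ω(χ φ, χ v)` for all `v` in the
space `W_h(ωs)` of dimension `N`, in increasing order and repeated according to multiplicity
(indices start at `0`). The eigenvalue is `∞` for functions with `a_ω(χ φ, ·) = 0` (these are
eigenfunctions for the eigenvalue `μ = 1 / λ = 0` of the reciprocal problem), and for indices
beyond the dimension. -/
structure IsEigensystem {d : ℕ} (Ω ΓD : Set (E d)) (A : E d → Matrix (Fin d) (Fin d) ℝ)
    (T : Set (Element d)) (ω ωs : Set (E d)) (χ : E d → ℝ) (N : ℕ) (lam : ℕ → ℝ≥0∞)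
    (φ : ℕ → E d → ℝ) : Prop where
  linearIndependent : LinearIndependent ℝ (fun k : Fin N => φ k)
  span_eq : (Submodule.span ℝ (Set.range fun k : Fin N => φ k) : Set (E d → ℝ)) = Wh Ω ΓD A T ωs
  eigen : ∀ k < N,
    (lam k ≠ ∞ ∧ ∀ v ∈ Wh Ω ΓD A T ωs,
      energy A ωs (φ k) v = (lam k).toReal * energy A ω (χ * φ k) (χ * v)) ∨
    (lam k = ∞ ∧ ∀ v ∈ Wh Ω ΓD A T ωs, energy A ω (χ * φ k) (χ * v) = 0)
  mono : Monotone lam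
  top : ∀ k, N ≤ k → lam k = ∞

/-- The local approximation space `S_{h,n}(ω)`, spanned by the restrictions to `ω` of the first `n`
eigenfunctions. -/
def localSpace {d : ℕ} (ω : Set (E d)) (φ : ℕ → E d → ℝ) (n : ℕ) : Submodule ℝ (E d → ℝ) :=
  Submodule.span ℝ ((fun k => ω.indicator (φ k)) '' {k | k < n})

/-- The global particular function `u_h^p = ∑ χ_i (ψ_i|_{ω_i})`. -/
def globalParticular {d M : ℕ} (ω : Fin M → Set (E d)) (χ ψ : Fin M → E d → ℝ) : E d → ℝ :=
  ∑ i, χ i * (ω i).indicator (ψ i)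

/-- The trial space `S_h(Ω)` of the functions `∑ χ_i v_i` with `v_i ∈ S_{h,n_i}(ω_i)`. -/
def globalSpace {d M : ℕ} (ω : Fin M → Set (E d)) (χ : Fin M → E d → ℝ)
    (φ : Fin M → ℕ → E d → ℝ) (n : Fin M → ℕ) : Set (E d → ℝ) :=
  {v | ∃ w : Fin M → E d → ℝ, (∀ i, w i ∈ localSpace (ω i) (φ i) (n i)) ∧ v = ∑ i, χ i * w i}

/-- The discrete MS-GFEM approximation `u = u_h^p + u_h^s` with particular function `up` and trial
space `S`: the Galerkin solution in `up + S`. -/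
def IsGalerkinSolution {d : ℕ} (Ω : Set (E d)) (A : E d → Matrix (Fin d) (Fin d) ℝ)
    (f : E d → ℝ) (g : (E d → ℝ) → ℝ) (up : E d → ℝ) (S : Set (E d → ℝ)) (u : E d → ℝ) : Prop :=
  ∃ us ∈ S, u = up + us ∧ ∀ v ∈ S, energy A Ω us v = load f g Ω v - energy A Ω up v

end MSGFEM

end

open MSGFEM

/-! ### Functions with bounded pointwise Lipschitz constants and their weak gradients. -/

namespace MSGFEM

variable {d : ℕ}

/-! On `ω_i^*` put `z_i = u_h^e - ψ_i`. It is discretely `A`-harmonic, because the fine-scale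
equation may be tested with functions of `V_{h,DI}(ω_i^*)` extended by zero
(`IsFineSolution.sub_mem_Wh`). It is also energy-orthogonal to both parts of `ψ_i`, so by Pythagoras
its energy on `ω_i^*` is at most that of `u_h^e` (`IsFineSolution.energy_sub_le`).

Truncating the eigenfunction expansion of `z_i` gives `v_i` in the span of the first `n_i`
eigenfunctions such that the squared energy norm of `χ_i (z_i - v_i)` is at most `1 / λ_{n_i+1}`
times that of `z_i` (`IsEigensystem.exists_approx`, resting on `eigen_truncation_le`). Here
`λ_{n_i+1} > 0` (`IsEigensystem.pos`): eigenfunctions for the eigenvalue `0` are constant, and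
constants are ruled out by the Dirichlet condition or used up by the first eigenfunction.

As `∑ χ_i = 1`, the error of the candidate `u_h^p + ∑ χ_i v_i` against `u_h^e` is `∑ χ_i (z_i -
v_i)`. The overlap bounds `κ` and `κ^*` add up the local estimates (`energy_sum_le`,
`sum_energy_le`). The products `χ_i v_i` need not be finite element functions, but they lie in
`H¹(Ω)` with zero trace on `∂Ω_D`. Hence Céa's lemma holds with respect to `u^e`
(`IsGalerkinSolution.energyNorm_sub_le`), and the triangle inequality through `u_h^e` finishes the
proof.

Finite element functions, the `χ_i` and their products all satisfy `BoundedLip`. This class is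
stable under products, and by Rademacher's theorem the weak gradient is the classical gradient
almost everywhere. -/

/-- Bounded functions on `ω` whose pointwise Lipschitz constants are uniformly bounded. -/
def BoundedLip (ω : Set (E d)) (u : E d → ℝ) : Prop :=
  ∃ C : ℝ, 0 ≤ C ∧ ∀ x ∈ ω, |u x| ≤ C ∧ ∀ᶠ z in 𝓝 x, |u z - u x| ≤ C * ‖z - x‖

/-- A mean value inequality along the segment from `x` to `y`. No derivative is needed, only a bound
on the right slopes of `|u - u x|` along the segment. -/
theorem abs_sub_le_of_eventually_le {s : Set (E d)} (hs : Convex ℝ s) {u : E d → ℝ} {C : ℝ}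
    (h : ∀ x ∈ s, ∀ᶠ z in 𝓝 x, |u z - u x| ≤ C * ‖z - x‖) {x y : E d} (hx : x ∈ s)
    (hy : y ∈ s) : |u y - u x| ≤ C * ‖y - x‖ := by
  have hline : ∀ t ∈ Icc (0 : ℝ) 1, x + t • (y - x) ∈ s := fun t ht =>
    hs.add_smul_sub_mem hx hy ht
  have hcu : ∀ z ∈ s, ContinuousAt u z := by
    intro z hz
    rw [ContinuousAt, tendsto_iff_norm_sub_tendsto_zero]
    have h1 : Tendsto (fun w => C * ‖w - z‖) (𝓝 z) (𝓝 0) := by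
      have : Continuous fun w : E d => C * ‖w - z‖ := by fun_prop
      simpa using this.tendsto z
    exact squeeze_zero' (Eventually.of_forall fun _ => norm_nonneg _) (h z hz) h1
  -- The comparison with the boundary function needs a strict inequality between slopes; `ε`
  -- provides the gap.
  have key : ∀ ε > 0, |u y - u x| ≤ C * ‖y - x‖ + ε := by
    intro ε hε
    have hf : ContinuousOn (fun t : ℝ => u (x + t • (y - x)) - u x) (Icc 0 1) := by
      intro t ht
      refine ContinuousAt.continuousWithinAt ?_
      refine ContinuousAt.sub ?_ continuousAt_const
      exact ContinuousAt.comp (f := fun t : ℝ => x + t • (y - x)) (hcu _ (hline t ht))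
        (by fun_prop)
    have := image_norm_le_of_liminf_right_slope_norm_lt_deriv_boundary (a := 0) (b := 1)
      (f := fun t : ℝ => u (x + t • (y - x)) - u x) (f' := fun _ => C * ‖y - x‖)
      (B := fun t => (C * ‖y - x‖ + ε) * t) (B' := fun _ => C * ‖y - x‖ + ε) hf ?_ (by simp)
      (by fun_prop) (fun t _ => by
        simpa using ((hasDerivAt_id t).const_mul (C * ‖y - x‖ + ε)).hasDerivWithinAt)
      (fun t _ _ => by linarith) (x := 1) (by simp)
    · simpa using this
    intro t ht r hr
    refine Eventually.frequently ?_
    have hc : Tendsto (fun z : ℝ => x + z • (y - x)) (𝓝[>] t) (𝓝 (x + t • (y - x))) := by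
      have : Continuous fun z : ℝ => x + z • (y - x) := by fun_prop
      exact (this.tendsto t).mono_left nhdsWithin_le_nhds
    filter_upwards [hc.eventually (h _ (hline t ⟨ht.1, ht.2.le⟩)), self_mem_nhdsWithin] with z hz hzt
    have hzt : 0 < z - t := sub_pos.2 hzt
    refine lt_of_le_of_lt ?_ hr
    rw [slope_def_field, div_le_iff₀ hzt]
    have h1 : x + z • (y - x) - (x + t • (y - x)) = (z - t) • (y - x) := by
      rw [sub_smul]; abel
    rw [h1, norm_smul, Real.norm_of_nonneg hzt.le] at hz
    have h2 := abs_abs_sub_abs_le (u (x + z • (y - x)) - u x) (u (x + t • (y - x)) - u x)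
    rw [sub_sub_sub_cancel_right] at h2
    simp only [Function.comp_apply, Real.norm_eq_abs]
    linarith [le_abs_self (|u (x + z • (y - x)) - u x| - |u (x + t • (y - x)) - u x|)]
  exact le_of_forall_pos_le_add key

namespace BoundedLip

variable {ω ω' : Set (E d)} {u v : E d → ℝ}

theorem mono (h : BoundedLip ω u) (hω : ω' ⊆ ω) : BoundedLip ω' u := by
  obtain ⟨C, hC, h⟩ := h
  exact ⟨C, hC, fun x hx => h x (hω hx)⟩

theorem congr (hω : IsOpen ω) (h : BoundedLip ω u) (huv : EqOn v u ω) : BoundedLip ω v := by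
  obtain ⟨C, hC, h⟩ := h
  refine ⟨C, hC, fun x hx => ⟨by rw [huv hx]; exact (h x hx).1, ?_⟩⟩
  filter_upwards [(h x hx).2, hω.mem_nhds hx] with z hz hzω
  rwa [huv hx, huv hzω]

theorem const (c : ℝ) : BoundedLip ω (fun _ => c) :=
  ⟨|c|, abs_nonneg c, fun _ _ => ⟨le_rfl, Eventually.of_forall fun _ => by simp; positivity⟩⟩

theorem add (hu : BoundedLip ω u) (hv : BoundedLip ω v) : BoundedLip ω (u + v) := by
  obtain ⟨C, hC, hu⟩ := hu
  obtain ⟨D, hD, hv⟩ := hv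
  refine ⟨C + D, by positivity, fun x hx => ⟨?_, ?_⟩⟩
  · exact (abs_add_le _ _).trans (add_le_add (hu x hx).1 (hv x hx).1)
  · filter_upwards [(hu x hx).2, (hv x hx).2] with z h1 h2
    calc |(u + v) z - (u + v) x| = |(u z - u x) + (v z - v x)| := by
          simp only [Pi.add_apply]; ring_nf
      _ ≤ _ := (abs_add_le _ _).trans (by rw [add_mul]; exact add_le_add h1 h2)

theorem mul (hu : BoundedLip ω u) (hv : BoundedLip ω v) : BoundedLip ω (u * v) := by
  obtain ⟨C, hC, hu⟩ := hu
  obtain ⟨D, hD, hv⟩ := hv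
  -- The first `C * D` bounds `|u v|`. The other two terms bound the slope, with `D + 1` bounding
  -- `|v|` near `x`.
  refine ⟨C * D + C * (D + 1) + C * D, by positivity, fun x hx => ⟨?_, ?_⟩⟩
  · rw [Pi.mul_apply, abs_mul]
    have := mul_le_mul (hu x hx).1 (hv x hx).1 (abs_nonneg _) hC
    nlinarith [mul_nonneg hC hD]
  · have h3 : ∀ᶠ z in 𝓝 x, D * ‖z - x‖ < 1 := by
      have : Continuous fun z : E d => D * ‖z - x‖ := by fun_prop
      exact this.continuousAt.eventually_lt continuousAt_const (by simp)
    filter_upwards [(hu x hx).2, (hv x hx).2, h3] with z h1 h2 h3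
    have hvz : |v z| ≤ D + 1 := by
      have := abs_sub_abs_le_abs_sub (v z) (v x)
      linarith [(hv x hx).1]
    calc |(u * v) z - (u * v) x| = |(u z - u x) * v z + u x * (v z - v x)| := by
          simp only [Pi.mul_apply]; ring_nf
      _ ≤ |u z - u x| * |v z| + |u x| * |v z - v x| := by
          refine (abs_add_le _ _).trans ?_
          rw [abs_mul, abs_mul]
      _ ≤ (C * ‖z - x‖) * (D + 1) + C * (D * ‖z - x‖) := by
          have := (hu x hx).1
          gcongr
      _ ≤ _ := by nlinarith [mul_nonneg (mul_nonneg hC hD) (norm_nonneg (z - x))]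

theorem smul (c : ℝ) (hu : BoundedLip ω u) : BoundedLip ω (c • u) :=
  (const c).mul hu

theorem zero : BoundedLip ω (0 : E d → ℝ) := const 0

theorem sum {ι : Type*} (s : Finset ι) {u : ι → E d → ℝ} (h : ∀ i ∈ s, BoundedLip ω (u i)) :
    BoundedLip ω (∑ i ∈ s, u i) :=
  Finset.sum_induction u (BoundedLip ω) (fun _ _ => add) zero h

theorem exists_lipschitzOnWith (h : BoundedLip ω u) :
    ∃ C : NNReal, ∀ s ⊆ ω, Convex ℝ s → LipschitzOnWith C u s := by
  obtain ⟨C, hC, h⟩ := h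
  refine ⟨⟨C, hC⟩, fun s hs hcs => LipschitzOnWith.of_dist_le_mul fun x hx y hy => ?_⟩
  rw [Real.dist_eq, dist_eq_norm]
  exact abs_sub_le_of_eventually_le hcs (fun z hz => (h z (hs hz)).2) hy hx

theorem continuousAt (h : BoundedLip ω u) {x : E d} (hx : x ∈ ω) : ContinuousAt u x := by
  obtain ⟨C, hC, h⟩ := h
  rw [ContinuousAt, tendsto_iff_norm_sub_tendsto_zero]
  have h1 : Tendsto (fun w => C * ‖w - x‖) (𝓝 x) (𝓝 0) := by
    have : Continuous fun w : E d => C * ‖w - x‖ := by fun_prop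
    simpa using this.tendsto x
  exact squeeze_zero' (Eventually.of_forall fun _ => norm_nonneg _) (h x hx).2 h1

theorem continuousOn (h : BoundedLip ω u) : ContinuousOn u ω :=
  fun _ hx => (h.continuousAt hx).continuousWithinAt

/-- A global Lipschitz bound may fail since `ω` need not be convex. Rademacher's theorem is applied
on balls inside `ω`, and being a null set is a local property. -/
theorem ae_differentiableAt (hω : IsOpen ω) (h : BoundedLip ω u) :
    ∀ᵐ x ∂volume.restrict ω, DifferentiableAt ℝ u x := by
  obtain ⟨C, hC⟩ := h.exists_lipschitzOnWith
  rw [ae_restrict_iff' hω.measurableSet, ae_iff]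
  refine measure_null_of_locally_null _ fun x hx => ?_
  simp only [Classical.not_imp, mem_ofPred_eq] at hx
  obtain ⟨r, hr, hrω⟩ := Metric.isOpen_iff.1 hω x hx.1
  refine ⟨_, inter_mem_nhdsWithin _ (Metric.ball_mem_nhds x hr), ?_⟩
  have := (hC _ hrω (convex_ball x r)).ae_differentiableWithinAt_of_mem (μ := volume)
  refine measure_mono_null ?_ (ae_iff.1 this)
  rintro z ⟨hz, hzb⟩
  simp only [Classical.not_imp, mem_ofPred_eq] at hz ⊢
  exact ⟨hzb, fun hd => hz.2 (hd.differentiableAt (Metric.isOpen_ball.mem_nhds hzb))⟩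

theorem exists_norm_fderiv_le (h : BoundedLip ω u) : ∃ C : ℝ, ∀ x ∈ ω, ‖fderiv ℝ u x‖ ≤ C := by
  obtain ⟨C, hC, h⟩ := h
  refine ⟨C, fun x hx => ?_⟩
  by_cases hd : DifferentiableAt ℝ u x
  · exact hd.hasFDerivAt.le_of_lip' hC (by simpa using (h x hx).2)
  · simpa [fderiv_zero_of_not_differentiableAt hd] using hC

end BoundedLip

theorem inner_gradient (u : E d → ℝ) (x e : E d) : inner ℝ (gradient u x) e = fderiv ℝ u x e := by
  simp [gradient]

theorem norm_gradient (u : E d → ℝ) (x : E d) : ‖gradient u x‖ = ‖fderiv ℝ u x‖ := by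
  simp [gradient]

theorem measurable_gradient (u : E d → ℝ) : Measurable (gradient u) :=
  (InnerProductSpace.toDual ℝ (E d)).symm.continuous.measurable.comp (measurable_fderiv ℝ u)

theorem BoundedLip.memLp {ω : Set (E d)} {u : E d → ℝ} (hω : IsOpen ω)
    (hb : Bornology.IsBounded ω) (h : BoundedLip ω u) : MemLp u 2 (volume.restrict ω) := by
  have : IsFiniteMeasure (volume.restrict ω) := ⟨by simpa using hb.measure_lt_top⟩
  have hc := h.continuousOn
  obtain ⟨C, -, h⟩ := h
  refine MemLp.of_bound (hc.aestronglyMeasurable hω.measurableSet) C ?_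
  exact (ae_restrict_iff' hω.measurableSet).2 (Eventually.of_forall fun x hx => (h x hx).1)

theorem BoundedLip.memLp_gradient {ω : Set (E d)} {u : E d → ℝ} (hω : IsOpen ω)
    (hb : Bornology.IsBounded ω) (h : BoundedLip ω u) :
    MemLp (gradient u) 2 (volume.restrict ω) := by
  have : IsFiniteMeasure (volume.restrict ω) := ⟨by simpa using hb.measure_lt_top⟩
  obtain ⟨C, hC⟩ := h.exists_norm_fderiv_le
  refine MemLp.of_bound (measurable_gradient u).aestronglyMeasurable C ?_
  refine (ae_restrict_iff' hω.measurableSet).2 (Eventually.of_forall fun x hx => ?_)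
  rw [norm_gradient]; exact hC x hx

/-- Integration by parts against the constant `1`. -/
theorem integral_lineDeriv_eq_zero {w : E d → ℝ} {C : NNReal} (hw : LipschitzWith C w)
    (hc : HasCompactSupport w) (e : E d) : ∫ x, lineDeriv ℝ w x e = 0 := by
  have := LipschitzWith.integral_lineDeriv_mul_eq (μ := (volume : Measure (E d)))
    (LipschitzWith.const (1 : ℝ)) hw hc (-e)
  have h0 : ∀ x, lineDeriv ℝ (fun _ : E d => (1 : ℝ)) x (-e) = 0 := fun x => by
    simp [lineDeriv]
  simp only [h0, zero_mul, integral_zero, neg_neg, mul_one] at this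
  exact this.symm

/-- For a test function `φ` the product `φ u` is Lipschitz on the whole space with compact support,
so its directional derivatives have integral zero; the product rule holds almost everywhere. -/
theorem BoundedLip.hasWeakGrad {ω : Set (E d)} {u : E d → ℝ} (hω : IsOpen ω)
    (hb : Bornology.IsBounded ω) (h : BoundedLip ω u) : HasWeakGrad ω u (gradient u) := by
  intro φ hφ hφc hφs e
  have hfin : IsFiniteMeasure (volume.restrict ω) := ⟨by simpa using hb.measure_lt_top⟩
  have hφd : Differentiable ℝ φ := hφ.differentiable (by simp)
  have hdc : Continuous (fderiv ℝ φ) := hφ.continuous_fderiv (by simp)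
  obtain ⟨C₁, hC₁⟩ := hφ.continuous.bounded_above_of_compact_support hφc
  obtain ⟨C₂, hC₂⟩ := hdc.bounded_above_of_compact_support (hφc.fderiv ℝ)
  have hφl : BoundedLip ω φ := by
    refine ⟨max C₁ C₂, le_max_of_le_left ((norm_nonneg _).trans (hC₁ 0)), fun x _ =>
      ⟨(hC₁ x).trans (le_max_left _ _), Eventually.of_forall fun z => ?_⟩⟩
    have := convex_univ.norm_image_sub_le_of_norm_fderiv_le (𝕜 := ℝ) (f := φ) (C := max C₁ C₂)
      (fun x _ => hφd x) (fun x _ => (hC₂ x).trans (le_max_right _ _)) (mem_univ x) (mem_univ z)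
    simpa using this
  -- Nothing is known about `u` outside `ω`, but `φ` vanishes near every point off its support.
  have hprod : BoundedLip univ (φ * u) := by
    obtain ⟨C, hC, hu⟩ := hφl.mul h
    refine ⟨C, hC, fun x _ => ?_⟩
    by_cases hx : x ∈ tsupport φ
    · exact hu x (hφs hx)
    · have h0 : ∀ᶠ z in 𝓝 x, φ z = 0 := by
        filter_upwards [(isClosed_tsupport φ).isOpen_compl.mem_nhds hx] with z hz
        exact image_eq_zero_of_notMem_tsupport hz
      refine ⟨by simpa [h0.self_of_nhds] using hC, ?_⟩
      filter_upwards [h0] with z hz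
      simp only [Pi.mul_apply, hz, h0.self_of_nhds]
      simp; positivity
  obtain ⟨L, hL⟩ := hprod.exists_lipschitzOnWith
  have hlip : LipschitzWith L (φ * u) :=
    lipschitzOnWith_univ.1 (hL univ subset_rfl convex_univ)
  have hzero := integral_lineDeriv_eq_zero hlip hφc.mul_right e
  have hout : ∀ x, x ∉ ω → lineDeriv ℝ (φ * u) x e = 0 := by
    intro x hx
    have h0 : (φ * u) =ᶠ[𝓝 x] 0 := by
      filter_upwards [(isClosed_tsupport φ).isOpen_compl.mem_nhds fun h => hx (hφs h)] with z hz
      simp [image_eq_zero_of_notMem_tsupport hz]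
    have : HasFDerivAt (φ * u) (0 : E d →L[ℝ] ℝ) x :=
      (hasFDerivAt_const (0 : ℝ) x).congr_of_eventuallyEq h0
    rw [this.hasLineDerivAt e |>.lineDeriv]; rfl
  rw [← setIntegral_eq_integral_of_forall_compl_eq_zero (s := ω) hout] at hzero
  have hae : ∀ᵐ x ∂volume.restrict ω, lineDeriv ℝ (φ * u) x e =
      u x * fderiv ℝ φ x e + φ x * inner ℝ (gradient u x) e := by
    filter_upwards [h.ae_differentiableAt hω] with x hx
    rw [((hφd x).mul hx).lineDeriv_eq_fderiv, fderiv_mul (hφd x) hx, inner_gradient]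
    simp; ring
  rw [integral_congr_ae hae, integral_add] at hzero
  · linarith
  · have hu := (h.memLp hω hb).integrable (by simp)
    refine hu.mul_bdd (c := C₂ * ‖e‖) ?_ ?_
    · exact (hdc.clm_apply continuous_const).aestronglyMeasurable
    · exact Eventually.of_forall fun x => (ContinuousLinearMap.le_opNorm _ _).trans
        (mul_le_mul_of_nonneg_right (hC₂ x) (norm_nonneg _))
  · have hg : Integrable (fun x => inner ℝ (gradient u x) e) (volume.restrict ω) :=
      ((h.memLp_gradient hω hb).integrable (by simp)).inner_const e
    exact hg.bdd_mul (c := C₁) hφ.continuous.aestronglyMeasurable (Eventually.of_forall hC₁)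

/-- The fundamental lemma of the calculus of variations for `G - H`, tested in each direction `e`.
-/
theorem HasWeakGrad.ae_eq {ω : Set (E d)} {u : E d → ℝ} {G H : E d → E d} (hω : IsOpen ω)
    (hb : Bornology.IsBounded ω)
    (hG : MemLp G 2 (volume.restrict ω)) (hH : MemLp H 2 (volume.restrict ω))
    (h₁ : HasWeakGrad ω u G) (h₂ : HasWeakGrad ω u H) : G =ᵐ[volume.restrict ω] H := by
  have hfin : IsFiniteMeasure (volume.restrict ω) := ⟨by simpa using hb.measure_lt_top⟩
  have hGi : IntegrableOn G ω := hG.integrable (by simp)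
  have hHi : IntegrableOn H ω := hH.integrable (by simp)
  have hoff : ∀ g : E d → ℝ, tsupport g ⊆ ω → ∀ x, x ∉ ω → g x • (G x - H x) = 0 := by
    intro g hg x hx
    rw [image_eq_zero_of_notMem_tsupport fun h => hx (hg h), zero_smul]
  have key := hω.ae_eq_zero_of_integral_contDiff_smul_eq_zero (μ := volume)
    (f := fun x => G x - H x) (hGi.sub hHi).locallyIntegrableOn (by
      intro g hg hgc hgs
      rw [← setIntegral_eq_integral_of_forall_compl_eq_zero (s := ω) (hoff g hgs)]
      obtain ⟨C, hC⟩ := hg.continuous.bounded_above_of_compact_support hgc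
      have hi : ∀ {F : E d → E d}, IntegrableOn F ω → IntegrableOn (fun x => g x • F x) ω :=
        fun hF => hF.bdd_smul C hg.continuous.aestronglyMeasurable (Eventually.of_forall hC)
      refine ext_inner_left ℝ fun e => ?_
      rw [← integral_inner (hi (F := fun x => G x - H x) (hGi.sub hHi)), inner_zero_right]
      have e1 := h₁ g hg hgc hgs e
      have e2 := h₂ g hg hgc hgs e
      have hs : ∀ x, inner ℝ e (g x • (G x - H x)) =
          g x * inner ℝ (G x) e - g x * inner ℝ (H x) e := by
        intro x
        rw [real_inner_comm, real_inner_smul_left, inner_sub_left]; ring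
      have hi' : ∀ {F : E d → E d}, IntegrableOn F ω →
          IntegrableOn (fun x => g x * inner ℝ (F x) e) ω := by
        intro F hF
        have := (hi hF).inner_const (𝕜 := ℝ) e
        simpa only [real_inner_smul_left, IntegrableOn] using this
      simp only [hs]
      rw [integral_sub (hi' hGi) (hi' hHi)]
      linarith)
  filter_upwards [(ae_restrict_iff' hω.measurableSet).2 key] with x hx
  exact sub_eq_zero.1 hx

theorem BoundedLip.mem_H1 {ω : Set (E d)} {u : E d → ℝ} (hω : IsOpen ω)
    (hb : Bornology.IsBounded ω) (h : BoundedLip ω u) : u ∈ H1 ω :=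
  ⟨h.memLp hω hb, gradient u, h.memLp_gradient hω hb, h.hasWeakGrad hω hb⟩

theorem weakGrad_spec {ω : Set (E d)} {u : E d → ℝ} (h : u ∈ H1 ω) :
    MemLp (weakGrad ω u) 2 (volume.restrict ω) ∧ HasWeakGrad ω u (weakGrad ω u) := by
  rw [weakGrad, dif_pos h.2]
  exact h.2.choose_spec

theorem BoundedLip.weakGrad_ae_eq {ω : Set (E d)} {u : E d → ℝ} (hω : IsOpen ω)
    (hb : Bornology.IsBounded ω) (h : BoundedLip ω u) :
    weakGrad ω u =ᵐ[volume.restrict ω] gradient u :=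
  have hs := weakGrad_spec (h.mem_H1 hω hb)
  hs.2.ae_eq hω hb hs.1 (h.memLp_gradient hω hb) (h.hasWeakGrad hω hb)

end MSGFEM

/-! ### Bilinearity and positivity of the energy. -/

namespace MSGFEM

variable {d : ℕ} {ω Ω : Set (E d)} {A : E d → Matrix (Fin d) (Fin d) ℝ} {α β : ℝ}
  {u v w : E d → ℝ}

-- `weakGrad` is a choice from a predicate on `G`. Functions equal on `ω` define the same predicate,
-- so the equality is literal and not merely almost everywhere.
open Classical in
theorem weakGrad_congr (hω : IsOpen ω) (h : EqOn u v ω) : weakGrad ω u = weakGrad ω v := by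
  have : ∀ G, HasWeakGrad ω u G ↔ HasWeakGrad ω v G := by
    intro G
    refine forall_congr' fun φ => forall_congr' fun _ => forall_congr' fun _ =>
      forall_congr' fun _ => forall_congr' fun e => ?_
    rw [setIntegral_congr_fun hω.measurableSet fun x hx => by
      rw [h hx]]
  have h2 : (fun G => MemLp G 2 (volume.restrict ω) ∧ HasWeakGrad ω u G) =
      fun G => MemLp G 2 (volume.restrict ω) ∧ HasWeakGrad ω v G :=
    funext fun G => by rw [this G]
  have key : ∀ P Q : (E d → E d) → Prop, P = Q →
      (if h : ∃ G, P G then h.choose else 0) = if h : ∃ G, Q G then h.choose else 0 := by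
    rintro P _ rfl; rfl
  exact key _ _ h2

theorem energy_congr (hω : IsOpen ω) {u' v' : E d → ℝ} (hu : EqOn u u' ω) (hv : EqOn v v' ω) :
    energy A ω u v = energy A ω u' v' := by
  rw [energy, energy, weakGrad_congr hω hu, weakGrad_congr hω hv]

theorem HasWeakGrad.add (hb : Bornology.IsBounded ω) {G H : E d → E d}
    (hu : MemLp u 2 (volume.restrict ω)) (hv : MemLp v 2 (volume.restrict ω))
    (hG : MemLp G 2 (volume.restrict ω)) (hH : MemLp H 2 (volume.restrict ω))
    (h₁ : HasWeakGrad ω u G) (h₂ : HasWeakGrad ω v H) : HasWeakGrad ω (u + v) (G + H) := by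
  have hfin : IsFiniteMeasure (volume.restrict ω) := ⟨by simpa using hb.measure_lt_top⟩
  intro φ hφ hφc hφs e
  have hdc : Continuous (fderiv ℝ φ) := hφ.continuous_fderiv (by simp)
  obtain ⟨C₁, hC₁⟩ := hφ.continuous.bounded_above_of_compact_support hφc
  obtain ⟨C₂, hC₂⟩ := hdc.bounded_above_of_compact_support (hφc.fderiv ℝ)
  have i1 : ∀ {u : E d → ℝ}, MemLp u 2 (volume.restrict ω) →
      Integrable (fun x => u x * fderiv ℝ φ x e) (volume.restrict ω) := fun hu =>
    (hu.integrable (by simp)).mul_bdd (c := C₂ * ‖e‖)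
      (hdc.clm_apply continuous_const).aestronglyMeasurable
      (Eventually.of_forall fun x => (ContinuousLinearMap.le_opNorm _ _).trans
        (mul_le_mul_of_nonneg_right (hC₂ x) (norm_nonneg _)))
  have i2 : ∀ {G : E d → E d}, MemLp G 2 (volume.restrict ω) →
      Integrable (fun x => φ x * inner ℝ (G x) e) (volume.restrict ω) := fun hG =>
    ((hG.integrable (by simp)).inner_const e).bdd_mul (c := C₁)
      hφ.continuous.aestronglyMeasurable (Eventually.of_forall hC₁)
  simp only [Pi.add_apply, inner_add_left, add_mul, mul_add]
  rw [integral_add (i1 hu) (i1 hv), integral_add (i2 hG) (i2 hH), h₁ φ hφ hφc hφs e,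
    h₂ φ hφ hφc hφs e, neg_add]

theorem HasWeakGrad.smul {G : E d → E d} (c : ℝ) (h : HasWeakGrad ω u G) :
    HasWeakGrad ω (c • u) (c • G) := by
  intro φ hφ hφc hφs e
  have e1 : ∀ x, (c • u) x * fderiv ℝ φ x e = c * (u x * fderiv ℝ φ x e) := fun x => by
    simp only [Pi.smul_apply, smul_eq_mul]; ring
  have e2 : ∀ x, φ x * inner ℝ ((c • G) x) e = c * (φ x * inner ℝ (G x) e) := fun x => by
    simp only [Pi.smul_apply, real_inner_smul_left]; ring
  simp only [e1, e2]
  rw [integral_const_mul, integral_const_mul, h φ hφ hφc hφs e, mul_neg]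

theorem H1.add (hb : Bornology.IsBounded ω) (hu : u ∈ H1 ω) (hv : v ∈ H1 ω) : u + v ∈ H1 ω := by
  obtain ⟨hu1, G, hG, hug⟩ := hu
  obtain ⟨hv1, H, hH, hvg⟩ := hv
  exact ⟨hu1.add hv1, G + H, hG.add hH, hug.add hb hu1 hv1 hG hH hvg⟩

theorem H1.smul (c : ℝ) (hu : u ∈ H1 ω) : c • u ∈ H1 ω := by
  obtain ⟨hu1, G, hG, hug⟩ := hu
  exact ⟨hu1.const_smul c, c • G, hG.const_smul c, hug.smul c⟩

theorem H1.sub (hb : Bornology.IsBounded ω) (hu : u ∈ H1 ω) (hv : v ∈ H1 ω) : u - v ∈ H1 ω := by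
  have := H1.add hb hu (H1.smul (-1) hv)
  rwa [neg_one_smul, ← sub_eq_add_neg] at this

theorem weakGrad_add (hω : IsOpen ω) (hb : Bornology.IsBounded ω) (hu : u ∈ H1 ω)
    (hv : v ∈ H1 ω) : weakGrad ω (u + v) =ᵐ[volume.restrict ω] weakGrad ω u + weakGrad ω v := by
  have h1 := weakGrad_spec hu
  have h2 := weakGrad_spec hv
  have h3 := weakGrad_spec (H1.add hb hu hv)
  exact h3.2.ae_eq hω hb h3.1 (h1.1.add h2.1) (h1.2.add hb hu.1 hv.1 h1.1 h2.1 h2.2)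

theorem weakGrad_smul (hω : IsOpen ω) (hb : Bornology.IsBounded ω) (c : ℝ) (hu : u ∈ H1 ω) :
    weakGrad ω (c • u) =ᵐ[volume.restrict ω] c • weakGrad ω u := by
  have h1 := weakGrad_spec hu
  have h3 := weakGrad_spec (H1.smul c hu)
  exact h3.2.ae_eq hω hb h3.1 (h1.1.const_smul c) (h1.2.smul c)

theorem IsCoefficient.mono (hA : IsCoefficient Ω A α β) (h : ω ⊆ Ω) : IsCoefficient ω A α β where
  aemeasurable i j := (hA.aemeasurable i j).mono_measure (Measure.restrict_mono h le_rfl)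
  symm := ae_restrict_of_ae_restrict_of_subset h hA.symm
  alpha_pos := hA.alpha_pos
  alpha_lt_beta := hA.alpha_lt_beta
  elliptic := ae_restrict_of_ae_restrict_of_subset h hA.elliptic

/-- The pointwise energy density `A ξ · η`. -/
def density (B : Matrix (Fin d) (Fin d) ℝ) (ξ η : E d) : ℝ := B.mulVec ξ.ofLp ⬝ᵥ η.ofLp

theorem density_add_left (B : Matrix (Fin d) (Fin d) ℝ) (ξ ξ' η : E d) :
    density B (ξ + ξ') η = density B ξ η + density B ξ' η := by
  simp [density, Matrix.mulVec_add]

theorem density_smul_left (B : Matrix (Fin d) (Fin d) ℝ) (c : ℝ) (ξ η : E d) :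
    density B (c • ξ) η = c * density B ξ η := by
  simp [density, Matrix.mulVec_smul]

theorem density_comm {B : Matrix (Fin d) (Fin d) ℝ} (hB : B.IsSymm) (ξ η : E d) :
    density B ξ η = density B η ξ := by
  rw [density, density, dotProduct_comm, Matrix.dotProduct_mulVec, ← Matrix.mulVec_transpose, hB.eq]

theorem density_add_right (B : Matrix (Fin d) (Fin d) ℝ) (ξ η η' : E d) :
    density B ξ (η + η') = density B ξ η + density B ξ η' := by
  simp [density]

theorem density_smul_right (B : Matrix (Fin d) (Fin d) ℝ) (c : ℝ) (ξ η : E d) :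
    density B ξ (c • η) = c * density B ξ η := by
  simp [density]

/-- Positivity of the form at `ξ + η` and `ξ - η`. -/
theorem abs_density_le {B : Matrix (Fin d) (Fin d) ℝ} (hB : B.IsSymm)
    (hpos : ∀ ξ : E d, 0 ≤ density B ξ ξ) (ξ η : E d) :
    |density B ξ η| ≤ (density B ξ ξ + density B η η) / 2 := by
  have h1 := hpos (ξ + η)
  have h2 := hpos (ξ + (-1 : ℝ) • η)
  simp only [density_add_left, density_add_right, density_smul_left, density_smul_right] at h1 h2
  rw [density_comm hB η ξ] at h1 h2
  rw [abs_le]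
  constructor <;> linarith

theorem IsCoefficient.density_self_nonneg (hA : IsCoefficient ω A α β) :
    ∀ᵐ x ∂volume.restrict ω, ∀ ξ, 0 ≤ density (A x) ξ ξ := by
  filter_upwards [hA.elliptic] with x hx ξ
  exact (mul_nonneg hA.alpha_pos.le (sq_nonneg _)).trans (hx ξ).1

theorem IsCoefficient.integrable_density (hA : IsCoefficient ω A α β) {G H : E d → E d}
    (hG : MemLp G 2 (volume.restrict ω)) (hH : MemLp H 2 (volume.restrict ω)) :
    Integrable (fun x => density (A x) (G x) (H x)) (volume.restrict ω) := by
  have hbound : Integrable (fun x => β / 2 * (‖G x‖ ^ 2 + ‖H x‖ ^ 2)) (volume.restrict ω) :=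
    ((hG.integrable_norm_pow (by simp)).add (hH.integrable_norm_pow (by simp))).const_mul _
  refine hbound.mono' ?_ ?_
  · refine AEMeasurable.aestronglyMeasurable ?_
    have hc : ∀ {G : E d → E d}, MemLp G 2 (volume.restrict ω) → ∀ i,
        AEMeasurable (fun x => (G x).ofLp i) (volume.restrict ω) := fun hG i =>
      (EuclideanSpace.proj (𝕜 := ℝ) i).continuous.measurable.comp_aemeasurable
        hG.aestronglyMeasurable.aemeasurable
    simp only [density, dotProduct, Matrix.mulVec]
    refine Finset.aemeasurable_fun_sum _ fun i _ => AEMeasurable.mul ?_ (hc hH i)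
    exact Finset.aemeasurable_fun_sum _ fun j _ => (hA.aemeasurable i j).mul (hc hG j)
  · filter_upwards [hA.symm, hA.elliptic, hA.density_self_nonneg] with x h1 h2 h3
    rw [Real.norm_eq_abs]
    refine (abs_density_le h1 h3 _ _).trans ?_
    have e1 : density (A x) (G x) (G x) ≤ β * ‖G x‖ ^ 2 := (h2 (G x)).2
    have e2 : density (A x) (H x) (H x) ≤ β * ‖H x‖ ^ 2 := (h2 (H x)).2
    linarith

theorem energy_eq_integral_density :
    energy A ω u v = ∫ x in ω, density (A x) (weakGrad ω u x) (weakGrad ω v x) := rfl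

theorem energy_comm (hA : IsCoefficient ω A α β) (u v : E d → ℝ) :
    energy A ω u v = energy A ω v u := by
  rw [energy_eq_integral_density, energy_eq_integral_density]
  refine integral_congr_ae ?_
  filter_upwards [hA.symm] with x hx
  exact density_comm hx _ _

theorem energy_self_nonneg (hA : IsCoefficient ω A α β) (u : E d → ℝ) : 0 ≤ energy A ω u u := by
  refine integral_nonneg_of_ae ?_
  filter_upwards [hA.density_self_nonneg] with x hx
  exact hx _

theorem energy_add_left (hω : IsOpen ω) (hb : Bornology.IsBounded ω) (hA : IsCoefficient ω A α β)
    (hu : u ∈ H1 ω) (hv : v ∈ H1 ω) (hw : w ∈ H1 ω) :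
    energy A ω (u + v) w = energy A ω u w + energy A ω v w := by
  simp only [energy_eq_integral_density]
  rw [← integral_add (hA.integrable_density (weakGrad_spec hu).1 (weakGrad_spec hw).1)
    (hA.integrable_density (weakGrad_spec hv).1 (weakGrad_spec hw).1)]
  refine integral_congr_ae ?_
  filter_upwards [weakGrad_add hω hb hu hv] with x hx
  rw [hx, Pi.add_apply, density_add_left]

theorem energy_smul_left (hω : IsOpen ω) (hb : Bornology.IsBounded ω) (c : ℝ) (hu : u ∈ H1 ω)
    (w : E d → ℝ) : energy A ω (c • u) w = c * energy A ω u w := by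
  simp only [energy_eq_integral_density]
  rw [← integral_const_mul]
  refine integral_congr_ae ?_
  filter_upwards [weakGrad_smul hω hb c hu] with x hx
  rw [hx, Pi.smul_apply, density_smul_left]

theorem energy_add_right (hω : IsOpen ω) (hb : Bornology.IsBounded ω) (hA : IsCoefficient ω A α β)
    (hu : u ∈ H1 ω) (hv : v ∈ H1 ω) (hw : w ∈ H1 ω) :
    energy A ω w (u + v) = energy A ω w u + energy A ω w v := by
  rw [energy_comm hA, energy_add_left hω hb hA hu hv hw, energy_comm hA u, energy_comm hA v]

theorem energy_smul_right (hω : IsOpen ω) (hb : Bornology.IsBounded ω)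
    (hA : IsCoefficient ω A α β) (c : ℝ) (hu : u ∈ H1 ω) (w : E d → ℝ) :
    energy A ω w (c • u) = c * energy A ω w u := by
  rw [energy_comm hA, energy_smul_left hω hb c hu, energy_comm hA u]

theorem energy_add_smul_self (hω : IsOpen ω) (hb : Bornology.IsBounded ω)
    (hA : IsCoefficient ω A α β) (hu : u ∈ H1 ω) (hv : v ∈ H1 ω) (t : ℝ) :
    energy A ω (u + t • v) (u + t • v) =
      energy A ω u u + 2 * t * energy A ω u v + t ^ 2 * energy A ω v v := by
  have htv := H1.smul t hv
  rw [energy_add_left hω hb hA hu htv (H1.add hb hu htv), energy_add_right hω hb hA hu htv hu,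
    energy_add_right hω hb hA hu htv htv, energy_smul_left hω hb t hv,
    energy_smul_left hω hb t hv, energy_smul_right hω hb hA t hv, energy_smul_right hω hb hA t hv,
    energy_comm hA v u]
  ring

/-- Cauchy–Schwarz comes from the discriminant of `t ↦ energy (u + t v)`, which needs only
semidefiniteness. -/
theorem energyNorm_add_le (hω : IsOpen ω) (hb : Bornology.IsBounded ω)
    (hA : IsCoefficient ω A α β) (hu : u ∈ H1 ω) (hv : v ∈ H1 ω) :
    energyNorm A ω (u + v) ≤ energyNorm A ω u + energyNorm A ω v := by
  have hquad : ∀ t : ℝ, 0 ≤ energy A ω v v * (t * t) + 2 * energy A ω u v * t + energy A ω u u := by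
    intro t
    have := energy_self_nonneg hA (u + t • v)
    rw [energy_add_smul_self hω hb hA hu hv] at this
    linarith
  have hdisc := discrim_le_zero hquad
  rw [discrim] at hdisc
  have h1 := energy_add_smul_self hω hb hA hu hv 1
  rw [one_smul] at h1
  have hu0 := energy_self_nonneg hA u
  have hv0 := energy_self_nonneg hA v
  have hcs : energy A ω u v ≤ Real.sqrt (energy A ω u u) * Real.sqrt (energy A ω v v) := by
    rw [← Real.sqrt_mul hu0]
    exact Real.le_sqrt_of_sq_le (by nlinarith)
  simp only [energyNorm]
  rw [h1]
  refine Real.sqrt_le_iff.2 ⟨by positivity, ?_⟩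
  nlinarith [Real.sq_sqrt hu0, Real.sq_sqrt hv0]

theorem energy_eq_integral_gradient (hω : IsOpen ω) (hb : Bornology.IsBounded ω)
    (hu : BoundedLip ω u) (hv : BoundedLip ω v) :
    energy A ω u v = ∫ x in ω, density (A x) (gradient u x) (gradient v x) := by
  rw [energy_eq_integral_density]
  refine integral_congr_ae ?_
  filter_upwards [hu.weakGrad_ae_eq hω hb, hv.weakGrad_ae_eq hω hb] with x h1 h2
  rw [h1, h2]

theorem weakGrad_zero (hω : IsOpen ω) (hb : Bornology.IsBounded ω) :
    weakGrad ω (0 : E d → ℝ) =ᵐ[volume.restrict ω] 0 := by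
  filter_upwards [(BoundedLip.zero (ω := ω)).weakGrad_ae_eq hω hb] with x hx
  rw [hx]
  simp [gradient]

theorem h1Norm_zero (hω : IsOpen ω) (hb : Bornology.IsBounded ω) :
    h1Norm ω (0 : E d → ℝ) = 0 := by
  have : ∫ x in ω, ‖weakGrad ω (0 : E d → ℝ) x‖ ^ 2 = 0 := by
    rw [integral_eq_zero_of_ae]
    filter_upwards [weakGrad_zero hω hb] with x hx
    simp [hx]
  simp [h1Norm, this]

/-- A function in `H¹(Ω)` that is continuous up to `Γ` and vanishes there has zero trace. -/
theorem mem_H1Zero_of_continuousOn {Γ : Set (E d)} (hΩ : IsOpen Ω) (hb : Bornology.IsBounded Ω)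
    (hΓ : MeasurableSet Γ) (hu : u ∈ H1 Ω) (hc : ContinuousOn u (Ω ∪ Γ))
    (h0 : ∀ x ∈ Γ, u x = 0) : u ∈ H1Zero Ω Γ := by
  -- The constant sequence `u` realises the trace.
  refine ⟨hu, fun _ => u, fun _ => ⟨hu, hc⟩, ?_, ?_⟩
  · simp [h1Norm_zero hΩ hb]
  · have : eLpNorm (u - 0) 2 ((Measure.hausdorffMeasure ((d : ℝ) - 1)).restrict Γ) = 0 := by
      rw [eLpNorm_congr_ae (g := 0), eLpNorm_zero]
      exact (ae_restrict_iff' hΓ).2 (Eventually.of_forall fun x hx => by simp [h0 x hx])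
    simp only [this]
    exact tendsto_const_nhds

end MSGFEM

/-! ### Mesh elements and finite element functions. -/

namespace MSGFEM

variable {d : ℕ} {ω Ω ΓD Γ : Set (E d)} {A : E d → Matrix (Fin d) (Fin d) ℝ} {α β : ℝ}
  {T : Set (Element d)} {K : Element d} {u v w p q : E d → ℝ}

namespace Element

theorem convex_carrier (K : Element d) : Convex ℝ K.carrier := by
  cases K with
  | simplex s => exact convex_convexHull ℝ _
  | box lo hi =>
    intro x hx y hy a b ha hb hab j
    simp only [PiLp.add_apply, PiLp.smul_apply, smul_eq_mul]
    constructor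
    · calc lo j = a * lo j + b * lo j := by rw [← add_mul, hab, one_mul]
        _ ≤ _ := by gcongr; exacts [(hx j).1, (hy j).1]
    · calc a * x j + b * y j ≤ a * hi j + b * hi j := by gcongr; exacts [(hx j).2, (hy j).2]
        _ = _ := by rw [← add_mul, hab, one_mul]

theorem isCompact_carrier (K : Element d) : IsCompact K.carrier := by
  cases K with
  | simplex s => exact s.finite_toSet.isCompact_convexHull ℝ
  | box lo hi =>
    have : (Element.box lo hi).carrier =
        (EuclideanSpace.equiv (Fin d) ℝ) ⁻¹' (Icc lo.ofLp hi.ofLp) := by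
      ext x
      simp [Element.carrier, Pi.le_def, forall_and]
    rw [this]
    exact (EuclideanSpace.equiv (Fin d) ℝ).toHomeomorph.isCompact_preimage.2 isCompact_Icc

theorem interior_carrier_nonempty (hK : K.Nondegenerate) : (interior K.carrier).Nonempty := by
  cases K with
  | simplex s =>
    obtain ⟨hc, hi⟩ := hK
    refine interior_convexHull_nonempty_iff_affineSpan_eq_top.2 ?_
    have := hi.affineSpan_eq_top_iff_card_eq_finrank_add_one.2 (by simpa using hc)
    simpa using this
  | box lo hi =>
    refine ⟨(1 / 2 : ℝ) • (lo + hi), mem_interior.2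
      ⟨⋂ j, {x : E d | lo j < x j} ∩ {x | x j < hi j}, ?_, ?_, ?_⟩⟩
    · intro x hx
      simp only [mem_iInter, mem_inter_iff, mem_ofPred_eq] at hx
      exact fun j => ⟨(hx j).1.le, (hx j).2.le⟩
    · refine isOpen_iInter_of_finite fun j => IsOpen.inter ?_ ?_
      · exact isOpen_lt continuous_const (by fun_prop)
      · exact isOpen_lt (by fun_prop) continuous_const
    · simp only [mem_iInter, mem_inter_iff, mem_ofPred_eq]
      intro j
      have := hK j
      simp only [PiLp.smul_apply, PiLp.add_apply, smul_eq_mul]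
      constructor <;> linarith

/-- Lets identities between continuous functions pass from the interior of an element to all of it.
-/
theorem subset_closure_interior (hK : K.Nondegenerate) :
    K.carrier ⊆ closure (interior K.carrier) := by
  rw [K.convex_carrier.closure_interior_eq_closure_of_nonempty_interior
    (interior_carrier_nonempty hK)]
  exact subset_closure

theorem IsShapeFunction.contDiff (h : K.IsShapeFunction p) : ContDiff ℝ 1 p := by
  cases K with
  | simplex s =>
    obtain ⟨c, b, h⟩ := h
    rw [funext h]
    exact contDiff_const.add (contDiff_const.inner ℝ contDiff_id)
  | box lo hi =>
    obtain ⟨c, h⟩ := h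
    rw [funext h]
    refine ContDiff.sum fun S _ => contDiff_const.mul (contDiff_prod fun j _ => ?_)
    exact (EuclideanSpace.proj (𝕜 := ℝ) j).contDiff

theorem IsShapeFunction.add (hp : K.IsShapeFunction p) (hq : K.IsShapeFunction q) :
    K.IsShapeFunction (p + q) := by
  cases K with
  | simplex s =>
    obtain ⟨c, b, h⟩ := hp
    obtain ⟨c', b', h'⟩ := hq
    refine ⟨c + c', b + b', fun x => ?_⟩
    rw [Pi.add_apply, h, h', inner_add_left]; ring
  | box lo hi =>
    obtain ⟨c, h⟩ := hp
    obtain ⟨c', h'⟩ := hq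
    refine ⟨c + c', fun x => ?_⟩
    simp only [Pi.add_apply, h, h', add_mul, Finset.sum_add_distrib]

theorem IsShapeFunction.smul (r : ℝ) (hp : K.IsShapeFunction p) :
    K.IsShapeFunction (r • p) := by
  cases K with
  | simplex s =>
    obtain ⟨c, b, h⟩ := hp
    refine ⟨r * c, r • b, fun x => ?_⟩
    rw [Pi.smul_apply, h, real_inner_smul_left, smul_eq_mul]; ring
  | box lo hi =>
    obtain ⟨c, h⟩ := hp
    refine ⟨r • c, fun x => ?_⟩
    simp only [Pi.smul_apply, h, smul_eq_mul, Finset.mul_sum, mul_assoc]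

theorem IsShapeFunction.zero : K.IsShapeFunction 0 := by
  cases K with
  | simplex s => exact ⟨0, 0, fun x => by simp⟩
  | box lo hi => exact ⟨0, fun x => by simp⟩

theorem IsShapeFunction.exists_bound (h : K.IsShapeFunction p) :
    ∃ C : ℝ, ∀ x ∈ K.carrier, |p x| ≤ C ∧ ∀ z ∈ K.carrier, |p z - p x| ≤ C * ‖z - x‖ := by
  have hc := h.contDiff
  obtain ⟨C₁, h₁⟩ := K.isCompact_carrier.exists_bound_of_continuousOn hc.continuous.continuousOn
  obtain ⟨C₂, h₂⟩ := K.isCompact_carrier.exists_bound_of_continuousOn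
    (hc.continuous_fderiv (by simp)).continuousOn
  refine ⟨max C₁ C₂, fun x hx => ⟨(h₁ x hx).trans (le_max_left _ _), fun z hz => ?_⟩⟩
  exact K.convex_carrier.norm_image_sub_le_of_norm_fderiv_le (𝕜 := ℝ)
    (fun x _ => (hc.differentiable (by simp)) x)
    (fun x hx => (h₂ x hx).trans (le_max_right _ _)) hx hz

end Element

theorem Vh.add (hu : u ∈ Vh Ω T) (hv : v ∈ Vh Ω T) : u + v ∈ Vh Ω T := by
  refine ⟨hu.1.add hv.1, fun x hx => by simp [hu.2.1 x hx, hv.2.1 x hx], fun K hK => ?_⟩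
  obtain ⟨p, hp, hup⟩ := hu.2.2 K hK
  obtain ⟨q, hq, hvq⟩ := hv.2.2 K hK
  exact ⟨p + q, hp.add hq, fun x hx => by simp [hup hx, hvq hx]⟩

theorem Vh.smul (c : ℝ) (hu : u ∈ Vh Ω T) : c • u ∈ Vh Ω T := by
  refine ⟨hu.1.const_smul c, fun x hx => by simp [hu.2.1 x hx], fun K hK => ?_⟩
  obtain ⟨p, hp, hup⟩ := hu.2.2 K hK
  exact ⟨c • p, hp.smul c, fun x hx => by simp [hup hx]⟩

theorem VhOn.add (hu : u ∈ VhOn Ω T ω) (hv : v ∈ VhOn Ω T ω) : u + v ∈ VhOn Ω T ω := by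
  obtain ⟨a, ha, rfl⟩ := hu
  obtain ⟨b, hb, rfl⟩ := hv
  exact ⟨a + b, Vh.add ha hb, (indicator_add' ω a b).symm⟩

theorem VhOn.smul (c : ℝ) (hu : u ∈ VhOn Ω T ω) : c • u ∈ VhOn Ω T ω := by
  obtain ⟨a, ha, rfl⟩ := hu
  exact ⟨c • a, Vh.smul c ha, (indicator_const_smul ω c a).symm⟩

theorem VhOn.sub (hu : u ∈ VhOn Ω T ω) (hv : v ∈ VhOn Ω T ω) : u - v ∈ VhOn Ω T ω := by
  have := VhOn.add hu (VhOn.smul (-1) hv)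
  rwa [neg_one_smul, ← sub_eq_add_neg] at this

theorem VhD_of_VhDI (h : v ∈ VhDI Ω ΓD T ω) : v ∈ VhD Ω ΓD T ω :=
  ⟨h.1, fun x hx => h.2 x (Or.inl hx)⟩

/-- On one element `v` is Lipschitz. Any element containing a point `z` close to `x` also contains
`x`, so the two values are compared inside a single element. -/
theorem Vh.boundedLip (hΩ : IsOpen Ω) (hT : IsMesh Ω T) (hv : v ∈ Vh Ω T) : BoundedLip Ω v := by
  have hch : ∀ K ∈ T, ∃ C : ℝ, ∀ x ∈ K.carrier ∩ Ω, |v x| ≤ C ∧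
      ∀ z ∈ K.carrier ∩ Ω, |v z - v x| ≤ C * ‖z - x‖ := by
    intro K hK
    obtain ⟨p, hp, hvp⟩ := hv.2.2 K hK
    obtain ⟨C, hC⟩ := hp.exists_bound
    refine ⟨C, fun x hx => ⟨by rw [hvp hx]; exact (hC x hx.1).1, fun z hz => ?_⟩⟩
    rw [hvp hx, hvp hz]; exact (hC x hx.1).2 z hz.1
  choose! C hC using hch
  have hnn : ∀ K ∈ hT.finite.toFinset, 0 ≤ |C K| := fun K _ => abs_nonneg _
  have hle : ∀ K ∈ T, C K ≤ ∑ K ∈ hT.finite.toFinset, |C K| := fun K hK =>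
    (le_abs_self _).trans
      (Finset.single_le_sum (f := fun K => |C K|) hnn (hT.finite.mem_toFinset.2 hK))
  have hcov : ∀ z ∈ Ω, ∃ K ∈ T, z ∈ K.carrier := by
    intro z hz
    have : z ∈ ⋃ K ∈ T, K.carrier := hT.cover ▸ subset_closure hz
    simpa using this
  refine ⟨∑ K ∈ hT.finite.toFinset, |C K|, Finset.sum_nonneg hnn, fun x hx => ⟨?_, ?_⟩⟩
  · obtain ⟨K, hK, hxK⟩ := hcov x hx
    exact ((hC K hK x ⟨hxK, hx⟩).1).trans (hle K hK)
  -- The elements are closed and finite in number, so those that miss `x` miss a neighbourhood of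
  -- `x`.
  · have hfar : ∀ᶠ z in 𝓝 x, ∀ K ∈ T, z ∈ K.carrier → x ∈ K.carrier := by
      rw [eventually_all_finite hT.finite]
      intro K _
      by_cases hxK : x ∈ K.carrier
      · exact Eventually.of_forall fun _ _ => hxK
      · filter_upwards [K.isCompact_carrier.isClosed.isOpen_compl.mem_nhds hxK] with z hz h
        exact absurd h hz
    filter_upwards [hfar, hΩ.mem_nhds hx] with z hz hzΩ
    obtain ⟨K, hK, hzK⟩ := hcov z hzΩ
    exact ((hC K hK x ⟨hz K hK hzK, hx⟩).2 z ⟨hzK, hzΩ⟩).trans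
      (mul_le_mul_of_nonneg_right (hle K hK) (norm_nonneg _))

theorem VhOn.boundedLip (hΩ : IsOpen Ω) (hT : IsMesh Ω T) (hω : IsOpen ω) (hωΩ : ω ⊆ Ω)
    (hv : v ∈ VhOn Ω T ω) : BoundedLip ω v := by
  obtain ⟨w, hw, rfl⟩ := hv
  exact ((Vh.boundedLip hΩ hT hw).mono hωΩ).congr hω (eqOn_indicator)

theorem VhOn.eq_zero (hv : v ∈ VhOn Ω T ω) {x : E d} (hx : x ∉ ω) : v x = 0 := by
  obtain ⟨w, -, rfl⟩ := hv
  exact indicator_of_notMem hx w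

/-- Frontiers of convex sets are null sets. -/
theorem IsMesh.ae_mem_interior (hΩ : IsOpen Ω) (hT : IsMesh Ω T) :
    ∀ᵐ x ∂volume.restrict Ω, ∃ K ∈ T, x ∈ interior K.carrier := by
  rw [ae_restrict_iff' hΩ.measurableSet]
  have h : ∀ᵐ x ∂(volume : Measure (E d)), ∀ K ∈ T, x ∉ frontier K.carrier := by
    rw [ae_ball_iff hT.finite.countable]
    exact fun K _ => measure_eq_zero_iff_ae_notMem.1 (K.convex_carrier.addHaar_frontier volume)
  filter_upwards [h] with x hx hxΩ
  have : x ∈ ⋃ K ∈ T, K.carrier := hT.cover ▸ subset_closure hxΩ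
  simp only [mem_iUnion, exists_prop] at this
  obtain ⟨K, hK, hxK⟩ := this
  refine ⟨K, hK, ?_⟩
  by_contra hn
  exact hx K hK ⟨subset_closure hxK, hn⟩

theorem tendsto_zero_of_eq_zero_compl {x : E d} (h0 : ∀ z, z ∉ ω → v z = 0)
    (h : x ∈ closure ω → Tendsto v (𝓝[ω] x) (𝓝 0)) : Tendsto v (𝓝 x) (𝓝 0) := by
  rw [← nhdsWithin_univ, ← union_compl_self ω, nhdsWithin_union, tendsto_sup]
  constructor
  · by_cases hx : x ∈ closure ω
    · exact h hx
    · rw [mem_closure_iff_nhdsWithin_neBot, not_neBot] at hx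
      simp [hx]
  · refine tendsto_const_nhds.congr' ?_
    filter_upwards [self_mem_nhdsWithin] with z hz
    exact (h0 z hz).symm

theorem mem_frontier_of_mem_closure (hΩ : IsOpen Ω) (hω : IsOpen ω) (hωΩ : ω ⊆ Ω)
    (hΓ : Γ ⊆ frontier Ω) {x : E d} (hx : x ∈ Γ) (hc : x ∈ closure ω) : x ∈ frontier ω ∩ Γ := by
  refine ⟨⟨hc, fun h => ?_⟩, hx⟩
  rw [hω.interior_eq] at h
  exact (hΓ hx).2 (hΩ.interior_eq.symm ▸ hωΩ h)

theorem VhD.tendsto_zero (hΩ : IsOpen Ω) (hω : IsOpen ω) (hωΩ : ω ⊆ Ω) (hΓD : ΓD ⊆ frontier Ω)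
    (hv : v ∈ VhD Ω ΓD T ω) {x : E d} (hx : x ∈ ΓD) : Tendsto v (𝓝 x) (𝓝 0) :=
  tendsto_zero_of_eq_zero_compl (fun _ hz => VhOn.eq_zero hv.1 hz) fun hc =>
    hv.2 x (mem_frontier_of_mem_closure hΩ hω hωΩ hΓD hx hc)

/-- Functions in `V_{h,DI}(ω)`, extended by zero, belong to `V_h`. -/
theorem VhDI.mem_Vh (hΩ : IsOpen Ω) (hT : IsMesh Ω T) (hω : IsOpen ω) (hωΩ : ω ⊆ Ω)
    (hres : Resolves T ω) (hv : v ∈ VhDI Ω ΓD T ω) : v ∈ Vh Ω T := by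
  have hcont : ContinuousOn v Ω := by
    intro x hx
    refine ContinuousAt.continuousWithinAt ?_
    by_cases hxω : x ∈ ω
    · exact (VhOn.boundedLip hΩ hT hω hωΩ hv.1).continuousAt hxω
    · rw [ContinuousAt, VhOn.eq_zero hv.1 hxω]
      refine tendsto_zero_of_eq_zero_compl (fun _ hz => VhOn.eq_zero hv.1 hz) fun hc => ?_
      exact hv.2 x (Or.inr ⟨⟨hc, by rwa [hω.interior_eq]⟩, hx⟩)
  refine ⟨hcont, fun x hx => VhOn.eq_zero hv.1 fun h => hx (hωΩ h), fun K hK => ?_⟩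
  rcases hres K hK with hint | hdis
  · obtain ⟨w, hw, rfl⟩ := hv.1
    obtain ⟨p, hp, hwp⟩ := hw.2.2 K hK
    -- The point `x` may lie outside `ω`, where `v` is `0` and not `w`. The identity `v = p` is
    -- therefore carried from the interior of `K` to `x` by continuity of both sides.
    refine ⟨p, hp, fun x hx => ?_⟩
    have hne : (𝓝[interior K.carrier] x).NeBot := mem_closure_iff_nhdsWithin_neBot.1
      (K.subset_closure_interior (hT.nondegenerate K hK) hx.1)
    have h1 : Tendsto (ω.indicator w) (𝓝[interior K.carrier] x) (𝓝 (ω.indicator w x)) :=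
      (hcont x hx.2).mono_left (nhdsWithin_mono _ (hint.trans hωΩ))
    have h2 : Tendsto p (𝓝[interior K.carrier] x) (𝓝 (p x)) :=
      hp.contDiff.continuous.continuousAt.mono_left nhdsWithin_le_nhds
    refine tendsto_nhds_unique (h1.congr' ?_) h2
    filter_upwards [self_mem_nhdsWithin] with z hz
    rw [indicator_of_mem (hint hz), hwp ⟨interior_subset hz, hωΩ (hint hz)⟩]
  · exact ⟨0, .zero, fun x hx => VhOn.eq_zero hv.1 (disjoint_left.1 hdis hx.1)⟩

/-- On functions vanishing outside a subdomain resolved by the mesh the energy is local. -/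
theorem energy_eq_of_eq_zero_outside (hΩ : IsOpen Ω) (hb : Bornology.IsBounded Ω)
    (hT : IsMesh Ω T) (hω : IsOpen ω) (hωΩ : ω ⊆ Ω) (hres : Resolves T ω)
    (hu : BoundedLip Ω u) (hv : BoundedLip Ω v) (h0 : ∀ x, x ∉ ω → v x = 0) :
    energy A Ω u v = energy A ω u v := by
  rw [energy_eq_integral_gradient hΩ hb hu hv, energy_eq_integral_gradient hω (hb.subset hωΩ)
    (hu.mono hωΩ) (hv.mono hωΩ)]
  refine setIntegral_eq_of_subset_of_ae_sdiff_eq_zero hΩ.measurableSet.nullMeasurableSet hωΩ ?_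
  -- Almost every point of `Ω \ ω` is interior to an element disjoint from `ω`, so `v` vanishes near
  -- it.
  filter_upwards [(ae_restrict_iff' hΩ.measurableSet).1 (hT.ae_mem_interior hΩ)] with x hx hxd
  obtain ⟨K, hK, hxK⟩ := hx hxd.1
  have hdis : Disjoint K.carrier ω := (hres K hK).resolve_left fun h => hxd.2 (h hxK)
  have hzero : v =ᶠ[𝓝 x] fun _ => 0 := by
    filter_upwards [isOpen_interior.mem_nhds hxK] with z hz
    exact h0 z (disjoint_left.1 hdis (interior_subset hz))
  have : gradient v x = 0 := by
    rw [gradient, hzero.fderiv_eq]; simp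
  simp [this, density]

theorem gradient_ae_eq_zero_of_energy_eq_zero (hω : IsOpen ω) (hb : Bornology.IsBounded ω)
    (hA : IsCoefficient ω A α β) (hu : BoundedLip ω u) (h : energy A ω u u = 0) :
    ∀ᵐ x ∂volume.restrict ω, fderiv ℝ u x = 0 := by
  rw [energy_eq_integral_gradient hω hb hu hu, integral_eq_zero_iff_of_nonneg_ae
    (hA.density_self_nonneg.mono fun x hx => hx _)
    (hA.integrable_density (hu.memLp_gradient hω hb) (hu.memLp_gradient hω hb))] at h
  filter_upwards [h, hA.elliptic] with x hx he
  have h1 : α * ‖gradient u x‖ ^ 2 ≤ 0 := (he _).1.trans_eq hx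
  have h2 : ‖gradient u x‖ ^ 2 ≤ 0 := by
    by_contra! hlt
    nlinarith [mul_pos hA.alpha_pos hlt]
  rw [norm_gradient] at h2
  exact norm_eq_zero.1 (pow_eq_zero_iff two_ne_zero |>.1 (le_antisymm h2 (sq_nonneg _)))

/-- Finite element functions with zero energy on a connected subdomain resolved by the mesh are
constant. -/
theorem VhOn.exists_eq_const_of_energy_eq_zero (hΩ : IsOpen Ω) (hb : Bornology.IsBounded Ω)
    (hT : IsMesh Ω T) (hω : IsOpen ω) (hωΩ : ω ⊆ Ω) (hconn : IsConnected ω)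
    (hres : Resolves T ω) (hA : IsCoefficient Ω A α β) (hv : v ∈ VhOn Ω T ω)
    (h : energy A ω v v = 0) : ∃ c, ∀ x ∈ ω, v x = c := by
  have hlip := VhOn.boundedLip hΩ hT hω hωΩ hv
  have hgrad := gradient_ae_eq_zero_of_energy_eq_zero hω (hb.subset hωΩ) (hA.mono hωΩ) hlip h
  have hK : ∀ K ∈ T, ∃ c, ∀ x ∈ K.carrier ∩ ω, v x = c := by
    intro K hK
    rcases hres K hK with hint | hdis
    · obtain ⟨w, hw, rfl⟩ := hv
      obtain ⟨p, hp, hwp⟩ := hw.2.2 K hK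
      have heq : ∀ x ∈ K.carrier ∩ ω, ω.indicator w x = p x := fun x hx => by
        rw [indicator_of_mem hx.2, hwp ⟨hx.1, hωΩ hx.2⟩]
      have hpd : ∀ᵐ x ∂volume.restrict (interior K.carrier), fderiv ℝ p x = 0 := by
        filter_upwards [ae_restrict_of_ae_restrict_of_subset hint hgrad,
          ae_restrict_mem isOpen_interior.measurableSet] with x hx hxK
        rw [← hx]
        refine Filter.EventuallyEq.fderiv_eq ?_
        filter_upwards [isOpen_interior.mem_nhds hxK] with z hz
        exact (heq z ⟨interior_subset hz, hint hz⟩).symm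
      -- The derivative of the shape function is continuous, so vanishing almost everywhere on an
      -- open set means vanishing there.
      have hp0 : EqOn (fderiv ℝ p) 0 (interior K.carrier) :=
        Measure.eqOn_open_of_ae_eq hpd isOpen_interior
          (hp.contDiff.continuous_fderiv (by simp)).continuousOn continuousOn_const
      obtain ⟨c, hc⟩ := isOpen_interior.exists_is_const_of_fderiv_eq_zero
        K.convex_carrier.interior.isPreconnected
        (hp.contDiff.differentiable (by simp)).differentiableOn hp0
      refine ⟨c, fun x hx => ?_⟩
      rw [heq x hx]
      have hcl : closure (interior K.carrier) ⊆ {x | p x = c} :=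
        closure_minimal hc (isClosed_eq hp.contDiff.continuous continuous_const)
      exact hcl (K.subset_closure_interior (hT.nondegenerate K hK) hx.1)
    · exact ⟨0, fun x hx => absurd hx.2 (disjoint_left.1 hdis hx.1)⟩
  choose! c hc using hK
  -- One value per element gives a finite image, and a connected subset of `ℝ` with two points is
  -- infinite.
  have hfin : (v '' ω).Finite := by
    refine (hT.finite.image c).subset ?_
    rintro _ ⟨x, hx, rfl⟩
    have : x ∈ ⋃ K ∈ T, K.carrier := hT.cover ▸ subset_closure (hωΩ hx)
    simp only [mem_iUnion, exists_prop] at this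
    obtain ⟨K, hK, hxK⟩ := this
    exact ⟨K, hK, (hc K hK x ⟨hxK, hx⟩).symm⟩
  have hsub : (v '' ω).Subsingleton := by
    rw [← not_nontrivial_iff]
    intro hnt
    exact (hconn.isPreconnected.image v hlip.continuousOn).infinite_of_nontrivial hnt hfin
  obtain ⟨x₀, hx₀⟩ := hconn.nonempty
  exact ⟨v x₀, fun x hx => hsub (mem_image_of_mem v hx) (mem_image_of_mem v hx₀)⟩

end MSGFEM

/-! ### Regularity of the partition of unity and finite overlap. -/

namespace MSGFEM

variable {d M : ℕ} {Ω ΓD : Set (E d)} {A : E d → Matrix (Fin d) (Fin d) ℝ} {α β C₁ : ℝ}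
  {T : Set (Element d)} {u v w : E d → ℝ} {ω ωs : Fin M → Set (E d)} {χ : Fin M → E d → ℝ}

namespace IsDecomposition

theorem subset (h : IsDecomposition Ω ω ωs χ C₁) (i : Fin M) : ω i ⊆ Ω :=
  (h.subset_over i).trans (h.over_subset i)

theorem differentiableAt (h : IsDecomposition Ω ω ωs χ C₁) {i : Fin M} {x : E d}
    (hx : x ∈ ω i) : DifferentiableAt ℝ (χ i) x :=
  ((h.contDiffOn i).contDiffAt ((h.isOpen i).mem_nhds hx)).differentiableAt (by simp)

/-- Continuity across the boundary of `ω i` is forced by the partition of unity. If `x ∉ ω i`, the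
`χ j` with `x ∈ ω j` are continuous at `x` and add up to `1` there, which squeezes `χ i` between `0`
and a function tending to `0`. -/
theorem continuousAt (h : IsDecomposition Ω ω ωs χ C₁) (hΩ : IsOpen Ω) (i : Fin M) {x : E d}
    (hx : x ∈ Ω) : ContinuousAt (χ i) x := by
  classical
  by_cases hxi : x ∈ ω i
  · exact (h.differentiableAt hxi).continuousAt
  have hz : ∀ j, x ∉ ω j → χ j x = 0 := fun j hj => h.eq_zero j x ⟨hx, hj⟩
  let s : Finset (Fin M) := Finset.univ.filter fun j => x ∈ ω j
  have hs : ∑ j ∈ s, χ j x = 1 := by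
    rw [← h.sum_eq_one x hx, Finset.sum_filter]
    refine Finset.sum_congr rfl fun j _ => ?_
    split_ifs with hj
    · rfl
    · exact (hz j hj).symm
  have hcont : Tendsto (fun z => 1 - ∑ j ∈ s, χ j z) (𝓝 x) (𝓝 0) := by
    have : Tendsto (fun z => ∑ j ∈ s, χ j z) (𝓝 x) (𝓝 (∑ j ∈ s, χ j x)) :=
      tendsto_finsetSum _ fun j hj =>
        (h.differentiableAt (Finset.mem_filter.1 hj).2).continuousAt
    simpa [hs] using this.const_sub 1
  rw [ContinuousAt, hz i hxi]
  refine squeeze_zero' ?_ ?_ hcont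
  · filter_upwards [hΩ.mem_nhds hx] with z hzΩ using (h.range i z hzΩ).1
  · filter_upwards [hΩ.mem_nhds hx] with z hzΩ
    rw [← h.sum_eq_one z hzΩ]
    have hi : i ∉ s := fun hi => hxi (Finset.mem_filter.1 hi).2
    have := Finset.sum_le_sum_of_subset_of_nonneg (Finset.subset_univ (insert i s))
      (f := fun j => χ j z) fun j _ _ => (h.range j z hzΩ).1
    rw [Finset.sum_insert hi] at this
    linarith

/-- The gradient bound is available inside `ω i` only. From a point outside `ω i` to one inside, it
is used on the final piece of the segment, which lies in `ω i` and starts from the value `0`. -/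
theorem boundedLip (h : IsDecomposition Ω ω ωs χ C₁) (hΩ : IsOpen Ω) (i : Fin M) :
    BoundedLip Ω (χ i) := by
  -- The summand `1` absorbs the remainder in the definition of the derivative.
  set C : ℝ := |C₁ / Metric.diam (ω i)| + 1 with hC
  have hC0 : 0 ≤ C := by positivity
  have hin : ∀ x ∈ ω i, ∀ᶠ z in 𝓝 x, |χ i z - χ i x| ≤ C * ‖z - x‖ := by
    intro x hx
    filter_upwards [(h.differentiableAt hx).hasFDerivAt.isLittleO.def one_pos] with z hz
    have h1 : ‖fderiv ℝ (χ i) x (z - x)‖ ≤ |C₁ / Metric.diam (ω i)| * ‖z - x‖ :=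
      (ContinuousLinearMap.le_opNorm _ _).trans
        (mul_le_mul_of_nonneg_right ((h.grad_bound i x hx).trans (le_abs_self _)) (norm_nonneg _))
    rw [Real.norm_eq_abs, one_mul] at hz
    rw [Real.norm_eq_abs] at h1
    have h2 := abs_add_le (χ i z - χ i x - fderiv ℝ (χ i) x (z - x)) (fderiv ℝ (χ i) x (z - x))
    rw [sub_add_cancel] at h2
    rw [hC, add_mul, one_mul]
    linarith
  refine ⟨max C 1, by positivity, fun x hx => ⟨?_, ?_⟩⟩
  · rw [abs_of_nonneg (h.range i x hx).1]
    exact (h.range i x hx).2.trans (le_max_right _ _)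
  suffices ∀ᶠ z in 𝓝 x, |χ i z - χ i x| ≤ C * ‖z - x‖ by
    filter_upwards [this] with z hz
    exact hz.trans (mul_le_mul_of_nonneg_right (le_max_left _ _) (norm_nonneg _))
  by_cases hxi : x ∈ ω i
  · exact hin x hxi
  have h0 := h.eq_zero i x ⟨hx, hxi⟩
  obtain ⟨r, hr, hrΩ⟩ := Metric.isOpen_iff.1 hΩ x hx
  filter_upwards [Metric.ball_mem_nhds x hr] with z hz
  rw [h0, sub_zero]
  by_cases hzi : z ∈ ω i
  swap
  · rw [h.eq_zero i z ⟨hrΩ hz, hzi⟩]; simp; positivity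
  let γ : ℝ →ᵃ[ℝ] E d := AffineMap.lineMap x z
  have hγ : Continuous γ := AffineMap.lineMap_continuous
  have hγΩ : ∀ t ∈ Icc (0 : ℝ) 1, γ t ∈ Ω := fun t ht =>
    hrΩ ((convex_ball x r).lineMap_mem (Metric.mem_ball_self hr) hz ht)
  have hScomp : IsCompact (Icc (0 : ℝ) 1 ∩ γ ⁻¹' (ω i)ᶜ) :=
    isCompact_Icc.inter_right ((h.isOpen i).isClosed_compl.preimage hγ)
  -- `t₀` is the last parameter at which the segment is outside `ω i`.
  obtain ⟨t₀, ht₀, hmax⟩ := hScomp.exists_isGreatest ⟨0, by simp, by simpa [γ] using hxi⟩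
  have ht₀1 : t₀ < 1 := by
    refine lt_of_le_of_ne ht₀.1.2 fun h1 => ht₀.2 ?_
    rw [h1]; simpa [γ] using hzi
  have hafter : γ '' Ioc t₀ 1 ⊆ ω i := by
    rintro _ ⟨t, ht, rfl⟩
    by_contra hn
    exact absurd (hmax ⟨⟨ht₀.1.1.trans ht.1.le, ht.2⟩, hn⟩) (not_le.2 ht.1)
  have hle : ∀ t ∈ Ioc t₀ 1, |χ i z - χ i (γ t)| ≤ C * ‖z - x‖ := by
    intro t ht
    have := abs_sub_le_of_eventually_le ((convex_Ioc t₀ 1).affine_image γ)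
      (fun w hw => hin w (hafter hw)) (mem_image_of_mem γ ht)
      (mem_image_of_mem γ (right_mem_Ioc.2 ht₀1))
    have h1 : γ 1 = z := by simp [γ]
    rw [h1] at this
    refine this.trans (mul_le_mul_of_nonneg_left ?_ hC0)
    have h2 : z - γ t = (1 - t) • (z - x) := by
      simp only [γ, AffineMap.lineMap_apply, vsub_eq_sub, vadd_eq_add, sub_smul, one_smul]
      abel
    have ht0 : 0 ≤ t := ht₀.1.1.trans ht.1.le
    rw [h2, norm_smul, Real.norm_of_nonneg (by linarith [ht.2])]
    exact mul_le_of_le_one_left (norm_nonneg _) (by linarith)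
  have hlim : Tendsto (fun t => |χ i z - χ i (γ t)|) (𝓝[>] t₀) (𝓝 |χ i z - χ i (γ t₀)|) := by
    have h1 : ContinuousAt (fun t => χ i (γ t)) t₀ :=
      ContinuousAt.comp (f := γ) (h.continuousAt hΩ i (hγΩ t₀ ht₀.1)) hγ.continuousAt
    exact ((continuousAt_const.sub h1).abs).tendsto.mono_left nhdsWithin_le_nhds
  have := le_of_tendsto hlim (Filter.mem_of_superset (Ioc_mem_nhdsGT ht₀1) hle)
  rwa [h.eq_zero i _ ⟨hγΩ t₀ ht₀.1, ht₀.2⟩, sub_zero] at this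

/-- The boundary of `ω i` may have positive measure, so this is not just locality. Outside `ω i` the
function `χ i` attains its minimum `0`, so both terms of the product rule vanish. -/
theorem ae_gradient_mul_eq_zero (h : IsDecomposition Ω ω ωs χ C₁) (hΩ : IsOpen Ω) (i : Fin M)
    (hu : BoundedLip Ω u) :
    ∀ᵐ x ∂volume.restrict Ω, x ∉ ω i → gradient (χ i * u) x = 0 := by
  filter_upwards [(h.boundedLip hΩ i).ae_differentiableAt hΩ, hu.ae_differentiableAt hΩ,
    ae_restrict_mem hΩ.measurableSet] with x h1 h2 hx hxi
  have h0 := h.eq_zero i x ⟨hx, hxi⟩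
  have hmin : IsLocalMin (χ i) x := by
    filter_upwards [hΩ.mem_nhds hx] with z hz
    rw [h0]; exact (h.range i z hz).1
  rw [gradient, fderiv_mul h1 h2, hmin.fderiv_eq_zero, h0]
  simp

theorem eqOn_mul_indicator (h : IsDecomposition Ω ω ωs χ C₁) (i : Fin M) (v : E d → ℝ) :
    EqOn (χ i * (ω i).indicator v) (χ i * v) Ω := by
  intro x hx
  by_cases hxi : x ∈ ω i
  · simp [hxi]
  · simp [h.eq_zero i x ⟨hx, hxi⟩]

theorem mul_indicator_indicator (h : IsDecomposition Ω ω ωs χ C₁) (i : Fin M) (v : E d → ℝ) :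
    χ i * (ω i).indicator ((ωs i).indicator v) = χ i * (ω i).indicator v := by
  rw [indicator_indicator, inter_eq_left.2 (h.subset_over i)]

theorem boundedLip_mul_indicator (h : IsDecomposition Ω ω ωs χ C₁) (hΩ : IsOpen Ω)
    (hT : IsMesh Ω T) (i : Fin M) (hv : v ∈ VhOn Ω T (ωs i)) :
    BoundedLip Ω (χ i * (ω i).indicator v) := by
  obtain ⟨w, hw, rfl⟩ := hv
  rw [h.mul_indicator_indicator i]
  exact ((h.boundedLip hΩ i).mul (Vh.boundedLip hΩ hT hw)).congr hΩ (h.eqOn_mul_indicator i w)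

theorem ae_gradient_mul_indicator_eq_zero (h : IsDecomposition Ω ω ωs χ C₁) (hΩ : IsOpen Ω)
    (hT : IsMesh Ω T) (i : Fin M) (hv : v ∈ VhOn Ω T (ωs i)) :
    ∀ᵐ x ∂volume.restrict Ω, x ∉ ω i → gradient (χ i * (ω i).indicator v) x = 0 := by
  obtain ⟨w, hw, rfl⟩ := hv
  rw [h.mul_indicator_indicator i]
  filter_upwards [h.ae_gradient_mul_eq_zero hΩ i (Vh.boundedLip hΩ hT hw),
    ae_restrict_mem hΩ.measurableSet] with x hx hxΩ hxi
  rw [← hx hxi, gradient, gradient, Filter.EventuallyEq.fderiv_eq]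
  filter_upwards [hΩ.mem_nhds hxΩ] with z hz using h.eqOn_mul_indicator i w hz

theorem tendsto_mul_indicator_zero (h : IsDecomposition Ω ω ωs χ C₁) (hΩ : IsOpen Ω)
    (hΓD : ΓD ⊆ frontier Ω) (i : Fin M) (hv : v ∈ VhD Ω ΓD T (ωs i)) {x : E d} (hx : x ∈ ΓD) :
    Tendsto (χ i * (ω i).indicator v) (𝓝 x) (𝓝 0) := by
  have h1 := (VhD.tendsto_zero hΩ (h.isOpen_over i) (h.over_subset i) hΓD hv hx).abs
  rw [abs_zero] at h1
  refine squeeze_zero_norm (fun z => ?_) h1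
  rw [Pi.mul_apply, Real.norm_eq_abs, abs_mul]
  by_cases hz : z ∈ ω i
  · rw [indicator_of_mem hz, abs_of_nonneg (h.range i z (h.subset i hz)).1]
    exact mul_le_of_le_one_left (abs_nonneg _) (h.range i z (h.subset i hz)).2
  · simp [hz]

/-- Sums `∑ χ_i v_i` with `v_i` in `V_{h,D}(ω_i^*)` lie in `H¹(Ω)` with zero trace on `∂Ω_D`. -/
theorem sum_mem_H1Zero (h : IsDecomposition Ω ω ωs χ C₁) (hΩ : IsOpen Ω)
    (hb : Bornology.IsBounded Ω) (hT : IsMesh Ω T) (hΓD : IsBoundaryPart Ω ΓD)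
    {v : Fin M → E d → ℝ} (hv : ∀ i, v i ∈ VhD Ω ΓD T (ωs i)) :
    ∑ i, χ i * (ω i).indicator (v i) ∈ H1Zero Ω ΓD := by
  obtain ⟨U, hU, rfl⟩ := hΓD
  have hsub : U ∩ frontier Ω ⊆ frontier Ω := inter_subset_right
  have hlip : BoundedLip Ω (∑ i, χ i * (ω i).indicator (v i)) :=
    BoundedLip.sum _ fun i _ => h.boundedLip_mul_indicator hΩ hT i (hv i).1
  have h0 : ∀ x ∈ U ∩ frontier Ω, (∑ i, χ i * (ω i).indicator (v i)) x = 0 := by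
    intro x hx
    rw [Finset.sum_apply]
    refine Finset.sum_eq_zero fun i _ => ?_
    have : x ∉ ω i := fun hxi => (hsub hx).2 (hΩ.interior_eq.symm ▸ h.subset i hxi)
    simp [this]
  refine mem_H1Zero_of_continuousOn hΩ hb (hU.measurableSet.inter isClosed_frontier.measurableSet)
    (hlip.mem_H1 hΩ hb) (fun x hx => ContinuousAt.continuousWithinAt ?_) h0
  rcases hx with hx | hx
  · exact hlip.continuousAt hx
  · rw [ContinuousAt, h0 x hx]
    have := tendsto_finsetSum Finset.univ fun i _ =>
      h.tendsto_mul_indicator_zero hΩ hsub i (hv i) hx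
    rw [Finset.sum_const_zero] at this
    refine this.congr fun z => ?_
    rw [Finset.sum_apply]

end IsDecomposition

theorem density_sum_self_le {ι : Type*} {B : Matrix (Fin d) (Fin d) ℝ} (hB : B.IsSymm)
    (hpos : ∀ ξ : E d, 0 ≤ density B ξ ξ) (s : Finset ι) (ξ : ι → E d) :
    density B (∑ i ∈ s, ξ i) (∑ i ∈ s, ξ i) ≤ s.card * ∑ i ∈ s, density B (ξ i) (ξ i) := by
  have hl : ∀ η, density B (∑ i ∈ s, ξ i) η = ∑ i ∈ s, density B (ξ i) η := fun η =>
    map_sum (AddMonoidHom.mk' (fun ξ => density B ξ η) fun a b => density_add_left B a b η) ξ s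
  have hr : ∀ η, density B η (∑ i ∈ s, ξ i) = ∑ i ∈ s, density B η (ξ i) := fun η =>
    map_sum (AddMonoidHom.mk' (fun ξ => density B η ξ) fun a b => density_add_right B η a b) ξ s
  rw [hl]
  simp only [hr]
  calc ∑ i ∈ s, ∑ j ∈ s, density B (ξ i) (ξ j)
      ≤ ∑ i ∈ s, ∑ j ∈ s, (density B (ξ i) (ξ i) + density B (ξ j) (ξ j)) / 2 :=
        Finset.sum_le_sum fun i _ => Finset.sum_le_sum fun j _ =>
          (le_abs_self _).trans (abs_density_le hB hpos _ _)
    _ = _ := by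
      simp only [add_div, Finset.sum_add_distrib, Finset.sum_const, nsmul_eq_mul, ← Finset.sum_div]
      rw [← Finset.mul_sum, ← Finset.sum_div]; ring

/-- At almost every point only the gradients with `x ∈ ω i` survive, at most `κ` of them, so
`density_sum_self_le` gives the factor `κ` instead of `M`. -/
theorem energy_sum_le (hΩ : IsOpen Ω) (hb : Bornology.IsBounded Ω) (hA : IsCoefficient Ω A α β)
    (hω : ∀ i, IsOpen (ω i)) (hωΩ : ∀ i, ω i ⊆ Ω) {κ : ℕ}
    (hκ : ∀ x ∈ Ω, {i | x ∈ ω i}.ncard ≤ κ) {u : Fin M → E d → ℝ}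
    (hu : ∀ i, BoundedLip Ω (u i))
    (h0 : ∀ i, ∀ᵐ x ∂volume.restrict Ω, x ∉ ω i → gradient (u i) x = 0) :
    energy A Ω (∑ i, u i) (∑ i, u i) ≤ κ * ∑ i, energy A (ω i) (u i) (u i) := by
  classical
  have hlip := BoundedLip.sum Finset.univ fun i _ => hu i
  have hloc : ∀ i, energy A (ω i) (u i) (u i) =
      ∫ x in Ω, density (A x) (gradient (u i) x) (gradient (u i) x) := by
    intro i
    rw [energy_eq_integral_gradient (hω i) (hb.subset (hωΩ i)) ((hu i).mono (hωΩ i))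
      ((hu i).mono (hωΩ i))]
    refine (setIntegral_eq_of_subset_of_ae_sdiff_eq_zero hΩ.measurableSet.nullMeasurableSet
      (hωΩ i) ?_).symm
    filter_upwards [(ae_restrict_iff' hΩ.measurableSet).1 (h0 i)] with x hx hxd
    simp [hx hxd.1 hxd.2, density]
  have hint : ∀ i, Integrable (fun x => density (A x) (gradient (u i) x) (gradient (u i) x))
      (volume.restrict Ω) := fun i =>
    hA.integrable_density ((hu i).memLp_gradient hΩ hb) ((hu i).memLp_gradient hΩ hb)
  simp only [hloc]
  rw [← integral_finsetSum _ fun i _ => hint i, ← integral_const_mul,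
    energy_eq_integral_gradient hΩ hb hlip hlip]
  refine integral_mono_ae (hA.integrable_density (hlip.memLp_gradient hΩ hb)
    (hlip.memLp_gradient hΩ hb)) ((integrable_finsetSum _ fun i _ => hint i).const_mul _) ?_
  filter_upwards [hA.symm, hA.density_self_nonneg, ae_all_iff.2 h0,
    ae_all_iff.2 fun i => (hu i).ae_differentiableAt hΩ, ae_restrict_mem hΩ.measurableSet]
    with x hs hp h0 hd hx
  let s : Finset (Fin M) := Finset.univ.filter fun i => x ∈ ω i
  have hcard : (s.card : ℝ) ≤ κ := by
    have := hκ x hx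
    rw [← Set.ncard_coe_finset] at *
    refine Nat.cast_le.2 (le_trans (le_of_eq ?_) this)
    congr 1; ext i; simp [s]
  have hgrad : gradient (∑ i, u i) x = ∑ i ∈ s, gradient (u i) x := by
    have : gradient (∑ i, u i) x = ∑ i, gradient (u i) x := by
      simp only [gradient]
      rw [fderiv_sum fun i _ => hd i, map_sum]
    rw [this, Finset.sum_filter]
    refine Finset.sum_congr rfl fun i _ => ?_
    split_ifs with hi
    · rfl
    · exact h0 i hi
  rw [hgrad]
  refine (density_sum_self_le hs hp s _).trans ?_
  refine mul_le_mul hcard (Finset.sum_le_sum_of_subset_of_nonneg (Finset.subset_univ s)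
    fun i _ _ => hp _) (Finset.sum_nonneg fun i _ => hp _) (by positivity)

theorem sum_energy_le (hΩ : IsOpen Ω) (hb : Bornology.IsBounded Ω) (hA : IsCoefficient Ω A α β)
    (hω : ∀ i, IsOpen (ω i)) (hωΩ : ∀ i, ω i ⊆ Ω) {κ : ℕ}
    (hκ : ∀ x ∈ Ω, {i | x ∈ ω i}.ncard ≤ κ) (hu : BoundedLip Ω u) :
    ∑ i, energy A (ω i) u u ≤ κ * energy A Ω u u := by
  classical
  set f : E d → ℝ := fun x => density (A x) (gradient u x) (gradient u x)
  have hloc : ∀ i, energy A (ω i) u u = ∫ x in Ω, (ω i).indicator f x := by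
    intro i
    rw [energy_eq_integral_gradient (hω i) (hb.subset (hωΩ i)) (hu.mono (hωΩ i))
      (hu.mono (hωΩ i)), setIntegral_indicator (hω i).measurableSet, inter_eq_right.2 (hωΩ i)]
  have hint : Integrable f (volume.restrict Ω) :=
    hA.integrable_density (hu.memLp_gradient hΩ hb) (hu.memLp_gradient hΩ hb)
  simp only [hloc]
  rw [← integral_finsetSum _ fun i _ => hint.indicator (hω i).measurableSet,
    energy_eq_integral_gradient hΩ hb hu hu, ← integral_const_mul]
  refine integral_mono_ae (integrable_finsetSum _ fun i _ => hint.indicator (hω i).measurableSet)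
    (hint.const_mul _) ?_
  filter_upwards [hA.density_self_nonneg, ae_restrict_mem hΩ.measurableSet] with x hp hx
  have : ∑ i, (ω i).indicator f x = ({i | x ∈ ω i}.ncard : ℝ) * f x := by
    simp only [indicator_apply]
    rw [← Finset.sum_filter, Finset.sum_const, nsmul_eq_mul, ← Set.ncard_coe_finset]
    congr 3; ext i; simp
  rw [this]
  exact mul_le_mul_of_nonneg_right (Nat.cast_le.2 (hκ x hx)) (hp _)

end MSGFEM

/-! ### Truncated eigenvector expansions. -/

namespace MSGFEM

/-- Truncation of the expansion in generalized eigenvectors below the eigenvalue `Λ`. -/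
theorem eigen_truncation_le {V ι : Type*} [AddCommGroup V] [Module ℝ V] [Fintype ι]
    (a b : LinearMap.BilinForm ℝ V) (ha : ∀ u v, a u v = a v u) (hb : ∀ u v, b u v = b v u)
    (ha0 : ∀ u, 0 ≤ a u u) (φ : ι → V) (lam : ι → ℝ≥0∞)
    (heig : ∀ k, (lam k ≠ ∞ ∧ ∀ l, a (φ k) (φ l) = (lam k).toReal * b (φ k) (φ l)) ∨
      (lam k = ∞ ∧ ∀ l, b (φ k) (φ l) = 0))
    (c : ι → ℝ) {Λ : ℝ≥0∞} (hΛ : 0 < Λ) [DecidablePred fun k => lam k < Λ] :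
    b (∑ k, c k • φ k - ∑ k with lam k < Λ, c k • φ k)
      (∑ k, c k • φ k - ∑ k with lam k < Λ, c k • φ k) ≤
      (Λ⁻¹).toReal * a (∑ k, c k • φ k) (∑ k, c k • φ k) := by
  -- The reciprocals turn the eigenvalue `∞` into `0`; they are finite on the high part because `Λ >
  -- 0`.
  set μ : ι → ℝ := fun k => ((lam k)⁻¹).toReal
  set m : ℝ := (Λ⁻¹).toReal
  -- Cutting by eigenvalue and not by index never splits an eigenspace. This matters since the `φ k`
  -- need not be orthogonal within one.
  set low := ∑ k with lam k < Λ, c k • φ k with hlow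
  set s : Finset ι := Finset.univ.filter fun k => ¬ lam k < Λ with hs
  set high := ∑ k ∈ s, c k • φ k with hhigh
  have hsplit : ∑ k, c k • φ k = low + high := (Finset.sum_filter_add_sum_filter_not _ _ _).symm
  have hΛi : Λ⁻¹ ≠ ∞ := ENNReal.inv_ne_top.2 hΛ.ne'
  have hpos : ∀ k ∈ s, 0 < lam k := fun k hk =>
    hΛ.trans_le (not_lt.1 (Finset.mem_filter.1 hk).2)
  have hμle : ∀ k ∈ s, μ k ≤ m := fun k hk =>
    ENNReal.toReal_mono hΛi (ENNReal.inv_le_inv.2 (not_lt.1 (Finset.mem_filter.1 hk).2))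
  have hμ : ∀ k ∈ s, ∀ l, b (φ k) (φ l) = μ k * a (φ k) (φ l) := by
    intro k hk l
    rcases heig k with ⟨h1, h2⟩ | ⟨h1, h2⟩
    · have : (lam k).toReal ≠ 0 := (ENNReal.toReal_pos (hpos k hk).ne' h1).ne'
      rw [h2]
      simp only [μ, ENNReal.toReal_inv]
      field_simp
    · simp [h2, μ, h1]
  -- Using both eigenvalue equations, `a (φ k) (φ l)` equals `lam k * μ l` times itself, with a
  -- factor below `1`.
  have horth : ∀ k, lam k < Λ → ∀ l ∈ s, a (φ k) (φ l) = 0 := by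
    intro k hk l hl
    obtain ⟨h1, h2⟩ : lam k ≠ ∞ ∧ ∀ l, a (φ k) (φ l) = (lam k).toReal * b (φ k) (φ l) := by
      rcases heig k with h | h
      · exact h
      · exact absurd (h.1 ▸ hk) not_top_lt
    have h3 : a (φ k) (φ l) = ((lam k).toReal * μ l) * a (φ k) (φ l) := by
      conv_lhs => rw [h2, hb, hμ l hl, ha]
      ring
    have h4 : (lam k).toReal * μ l < 1 := by
      have hlt : lam k < lam l := hk.trans_le (not_lt.1 (Finset.mem_filter.1 hl).2)
      rw [← ENNReal.toReal_mul, ← div_eq_mul_inv, ← ENNReal.toReal_one]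
      exact (ENNReal.toReal_lt_toReal (ENNReal.div_ne_top h1 (hpos l hl).ne') ENNReal.one_ne_top).2
        (ENNReal.div_lt_of_lt_mul' (by simpa using hlt))
    have h5 : (1 - (lam k).toReal * μ l) * a (φ k) (φ l) = 0 := by linarith
    exact (mul_eq_zero.1 h5).resolve_left (by linarith)
  have hlh : a low high = 0 := by
    simp only [hlow, hhigh, map_sum, LinearMap.sum_apply, map_smul, LinearMap.smul_apply]
    refine Finset.sum_eq_zero fun l hl => ?_
    rw [Finset.sum_eq_zero, smul_zero]
    intro k hk
    rw [horth k (Finset.mem_filter.1 hk).2 l hl, smul_zero]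
  have hle : a high high ≤ a (low + high) (low + high) := by
    have h1 : a high low = 0 := by rw [ha, hlh]
    simp only [map_add, LinearMap.add_apply, hlh, h1]
    linarith [ha0 low]
  -- `a` couples only indices with equal `μ`, so the weight `m - μ k` may be distributed
  -- symmetrically as a product of square roots.
  have hblock : ∀ k ∈ s, ∀ l ∈ s, Real.sqrt (m - μ k) * Real.sqrt (m - μ l) * a (φ k) (φ l) =
      (m - μ k) * a (φ k) (φ l) := by
    intro k hk l hl
    by_cases he : μ k = μ l
    · rw [← he, Real.mul_self_sqrt (sub_nonneg.2 (hμle k hk))]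
    · have h1 : μ k * a (φ k) (φ l) = μ l * a (φ k) (φ l) := by
        rw [← hμ k hk l, hb, hμ l hl k, ha]
      have h2 : (μ k - μ l) * a (φ k) (φ l) = 0 := by linarith
      rw [(mul_eq_zero.1 h2).resolve_left (sub_ne_zero.2 he)]; simp
  -- The difference is the value of `a` on a rescaled vector, hence nonnegative; no orthonormal
  -- basis is needed.
  have hkey : m * a high high - b high high =
      a (∑ k ∈ s, (Real.sqrt (m - μ k) * c k) • φ k)
        (∑ k ∈ s, (Real.sqrt (m - μ k) * c k) • φ k) := by
    simp only [hhigh, map_sum, LinearMap.sum_apply, map_smul, LinearMap.smul_apply, smul_eq_mul,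
      Finset.mul_sum, ← Finset.sum_sub_distrib]
    refine Finset.sum_congr rfl fun k hk => Finset.sum_congr rfl fun l hl => ?_
    rw [hμ l hl k]
    linear_combination (-(c k * c l)) * hblock l hl k hk
  rw [hsplit, add_sub_cancel_left]
  have hm : 0 ≤ m := ENNReal.toReal_nonneg
  calc b high high ≤ m * a high high := by
        linarith [ha0 (∑ k ∈ s, (Real.sqrt (m - μ k) * c k) • φ k)]
    _ ≤ _ := mul_le_mul_of_nonneg_left hle hm

end MSGFEM

/-! ### Local spectral approximation and positivity of the eigenvalues. -/

namespace MSGFEM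

variable {d M : ℕ} {ω ωs Ω ΓD : Set (E d)} {A : E d → Matrix (Fin d) (Fin d) ℝ} {α β : ℝ}
  {T : Set (Element d)} {u v w z q f χ : E d → ℝ} {g : (E d → ℝ) → ℝ}

theorem energy_sub_left (hω : IsOpen ω) (hb : Bornology.IsBounded ω) (hA : IsCoefficient ω A α β)
    (hu : u ∈ H1 ω) (hv : v ∈ H1 ω) (hw : w ∈ H1 ω) :
    energy A ω (u - v) w = energy A ω u w - energy A ω v w := by
  rw [sub_eq_add_neg, ← neg_one_smul ℝ v, energy_add_left hω hb hA hu (H1.smul _ hv) hw,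
    energy_smul_left hω hb _ hv]
  ring

/-- The space of bounded functions with uniformly bounded pointwise Lipschitz constants. -/
def lipSubmodule (ω : Set (E d)) : Submodule ℝ (E d → ℝ) where
  carrier := {u | BoundedLip ω u}
  add_mem' := BoundedLip.add
  zero_mem' := BoundedLip.zero
  smul_mem' c _ := BoundedLip.smul c

/-- The bilinear form `(u, v) ↦ a_ω(χ u, χ v)`. -/
noncomputable def weightedEnergyForm (hω : IsOpen ω) (hb : Bornology.IsBounded ω)
    (hA : IsCoefficient ω A α β) (hsub : ω ⊆ ωs) (hχ : BoundedLip ω χ) :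
    LinearMap.BilinForm ℝ (lipSubmodule ωs) :=
  have hm : ∀ u : lipSubmodule ωs, χ * u.1 ∈ H1 ω := fun u =>
    (hχ.mul (u.2.mono hsub)).mem_H1 hω hb
  LinearMap.mk₂ ℝ (fun u v => energy A ω (χ * u.1) (χ * v.1))
    (fun u v w => by
      rw [Submodule.coe_add, mul_add, energy_add_left hω hb hA (hm u) (hm v) (hm w)])
    (fun c u v => by
      rw [Submodule.coe_smul, mul_smul_comm, energy_smul_left hω hb c (hm u), smul_eq_mul])
    (fun u v w => by
      rw [Submodule.coe_add, mul_add, energy_add_right hω hb hA (hm v) (hm w) (hm u)])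
    (fun c u v => by
      rw [Submodule.coe_smul, mul_smul_comm, energy_smul_right hω hb hA c (hm v), smul_eq_mul])

theorem weightedEnergyForm_apply (hω : IsOpen ω) (hb : Bornology.IsBounded ω)
    (hA : IsCoefficient ω A α β) (hsub : ω ⊆ ωs) (hχ : BoundedLip ω χ) (u v : lipSubmodule ωs) :
    weightedEnergyForm hω hb hA hsub hχ u v = energy A ω (χ * u.1) (χ * v.1) := rfl

/-- The restriction of functions to `ω`, extended by zero. -/
noncomputable def indicatorLinearMap (ω : Set (E d)) : (E d → ℝ) →ₗ[ℝ] (E d → ℝ) where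
  toFun := ω.indicator
  map_add' := indicator_add' ω
  map_smul' := indicator_const_smul ω

theorem mem_localSpace_iff {φ : ℕ → E d → ℝ} {n : ℕ} : v ∈ localSpace ω φ n ↔
    ∃ w ∈ Submodule.span ℝ (φ '' {k | k < n}), ω.indicator w = v := by
  have : localSpace ω φ n =
      (Submodule.span ℝ (φ '' {k | k < n})).map (indicatorLinearMap ω) := by
    rw [Submodule.map_span, image_image]; rfl
  rw [this, Submodule.mem_map]; rfl

namespace IsEigensystem

variable {N : ℕ} {lam : ℕ → ℝ≥0∞} {φ : ℕ → E d → ℝ}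

theorem mem_Wh (h : IsEigensystem Ω ΓD A T ω ωs χ N lam φ) {k : ℕ} (hk : k < N) :
    φ k ∈ Wh Ω ΓD A T ωs := by
  rw [← h.span_eq]
  exact Submodule.subset_span ⟨⟨k, hk⟩, rfl⟩

theorem span_subset_Wh (h : IsEigensystem Ω ΓD A T ω ωs χ N lam φ) {n : ℕ} (hn : n ≤ N)
    (hv : v ∈ Submodule.span ℝ (φ '' {k | k < n})) : v ∈ Wh Ω ΓD A T ωs := by
  rw [← h.span_eq]
  refine Submodule.span_mono ?_ hv
  rintro _ ⟨k, hk, rfl⟩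
  exact ⟨⟨k, lt_of_lt_of_le hk hn⟩, rfl⟩

theorem exists_approx (h : IsEigensystem Ω ΓD A T ω ωs χ N lam φ) (hΩ : IsOpen Ω)
    (hb : Bornology.IsBounded Ω) (hT : IsMesh Ω T) (hA : IsCoefficient Ω A α β) (hω : IsOpen ω)
    (hωs : IsOpen ωs) (hsub : ω ⊆ ωs) (hsubΩ : ωs ⊆ Ω) (hχ : BoundedLip ω χ)
    {n : ℕ} (hpos : 0 < lam n) (hz : z ∈ Wh Ω ΓD A T ωs) :
    ∃ v ∈ Submodule.span ℝ (φ '' {k | k < n}), energy A ω (χ * (z - v)) (χ * (z - v)) ≤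
      ((lam n)⁻¹).toReal * energy A ωs z z := by
  classical
  have hlip : ∀ k : Fin N, BoundedLip ωs (φ k) := fun k =>
    VhOn.boundedLip hΩ hT hωs hsubΩ (h.mem_Wh k.2).1.1
  rw [← h.span_eq] at hz
  obtain ⟨c, rfl⟩ := (Submodule.mem_span_range_iff_exists_fun ℝ).1 hz
  have hone : ∀ v : E d → ℝ, (1 : E d → ℝ) * v = v := one_mul
  -- The energy on `ωs` is the weighted form with weight `1`.
  have key := eigen_truncation_le
    (weightedEnergyForm hωs (hb.subset hsubΩ) (hA.mono hsubΩ) subset_rfl (BoundedLip.const 1))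
    (weightedEnergyForm hω (hb.subset (hsub.trans hsubΩ)) (hA.mono (hsub.trans hsubΩ)) hsub hχ)
    (fun u v => energy_comm (hA.mono hsubΩ) _ _)
    (fun u v => energy_comm (hA.mono (hsub.trans hsubΩ)) _ _)
    (fun u => energy_self_nonneg (hA.mono hsubΩ) _)
    (fun k : Fin N => (⟨φ k, hlip k⟩ : lipSubmodule ωs)) (fun k => lam k)
    (fun k => by
      simp only [weightedEnergyForm_apply]
      rw [show (fun _ : E d => (1 : ℝ)) = 1 from rfl]
      simp only [hone]
      exact (h.eigen k k.2).imp (fun hk => ⟨hk.1, fun l => hk.2 _ (h.mem_Wh l.2)⟩)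
        (fun hk => ⟨hk.1, fun l => hk.2 _ (h.mem_Wh l.2)⟩)) c hpos
  simp only [weightedEnergyForm_apply] at key
  rw [show (fun _ : E d => (1 : ℝ)) = 1 from rfl] at key
  simp only [hone, AddSubgroupClass.coe_sub, AddSubmonoidClass.coe_finsetSum,
    SetLike.val_smul] at key
  refine ⟨_, ?_, key⟩
  refine Submodule.sum_mem _ fun k hk => Submodule.smul_mem _ _ (Submodule.subset_span ⟨k, ?_, rfl⟩)
  -- The truncation uses only indices with `lam k < lam n`, and these satisfy `k < n` by
  -- monotonicity.
  by_contra hn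
  exact absurd (Finset.mem_filter.1 hk).2 (not_lt.2 (h.mono (not_lt.1 hn)))

/-- Only constants are eigenfunctions for the eigenvalue `0`. -/
theorem pos (h : IsEigensystem Ω ΓD A T ω ωs χ N lam φ) (hΩ : IsOpen Ω)
    (hb : Bornology.IsBounded Ω) (hT : IsMesh Ω T) (hA : IsCoefficient Ω A α β)
    (hωs : IsOpen ωs) (hconn : IsConnected ωs) (hsubΩ : ωs ⊆ Ω) (hres : Resolves T ωs) {n : ℕ}
    (hn : frontier ωs ∩ ΓD = ∅ → 1 ≤ n) : 0 < lam n := by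
  by_contra h0
  have h0 : lam n = 0 := by simpa using h0
  have hnN : n < N := by
    by_contra hN
    rw [h.top n (not_lt.1 hN)] at h0
    exact ENNReal.top_ne_zero h0
  have hconst : ∀ k ≤ n, ∃ c : ℝ, ∀ x ∈ ωs, φ k x = c := by
    intro k hk
    have hkN := hk.trans_lt hnN
    have hlam : lam k = 0 := le_antisymm (h0 ▸ h.mono hk) bot_le
    have hW := h.mem_Wh hkN
    refine VhOn.exists_eq_const_of_energy_eq_zero hΩ hb hT hωs hsubΩ hconn hres hA hW.1.1 ?_
    rcases h.eigen k hkN with h1 | h1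
    · rw [h1.2 _ hW, hlam]; simp
    · rw [hlam] at h1; exact absurd h1.1.symm ENNReal.top_ne_zero
  have hind : ∀ k ≤ n, ∃ c : ℝ, φ k = c • ωs.indicator 1 := by
    intro k hk
    obtain ⟨c, hc⟩ := hconst k hk
    refine ⟨c, funext fun x => ?_⟩
    by_cases hx : x ∈ ωs
    · simp [hx, hc x hx]
    · simp [hx, VhOn.eq_zero (h.mem_Wh (hk.trans_lt hnN)).1.1 hx]
  have hne : ∀ k : ℕ, ∀ hk : k < N, φ k ≠ 0 := fun k hk =>
    h.linearIndependent.ne_zero (⟨k, hk⟩ : Fin N)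
  -- Without a Dirichlet part `1 ≤ n`, so `φ 0` and `φ 1` are both multiples of one indicator,
  -- against independence. Otherwise the constant is `0` by its limit at a Dirichlet point, and `φ n
  -- = 0`.
  by_cases hΓ : frontier ωs ∩ ΓD = ∅
  · have h1 := hn hΓ
    obtain ⟨a, ha⟩ := hind 0 bot_le
    obtain ⟨b, hb⟩ := hind 1 h1
    have h1N : 1 < N := h1.trans_lt hnN
    have hli := h.linearIndependent.comp ![⟨0, by omega⟩, ⟨1, h1N⟩] (by
      intro i j hij
      fin_cases i <;> fin_cases j <;> simp_all)
    have hpair : LinearIndependent ℝ ![φ 0, φ 1] := by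
      convert hli using 1
      ext i : 1
      fin_cases i <;> rfl
    have hb0 := (LinearIndependent.pair_iff.1 hpair b (-a) (by
      rw [ha, hb, smul_smul, smul_smul, ← add_smul, neg_mul, mul_comm b a, add_neg_cancel,
        zero_smul])).1
    exact hne 1 h1N (by rw [hb, hb0, zero_smul])
  · obtain ⟨x, hx⟩ := nonempty_iff_ne_empty.2 hΓ
    obtain ⟨c, hc⟩ := hconst n le_rfl
    have hne' : (𝓝[ωs] x).NeBot :=
      mem_closure_iff_nhdsWithin_neBot.1 (frontier_subset_closure hx.1)
    have hlim := (h.mem_Wh hnN).1.2 x hx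
    have hlim' : Tendsto (φ n) (𝓝[ωs] x) (𝓝 c) := by
      refine tendsto_const_nhds.congr' ?_
      filter_upwards [self_mem_nhdsWithin] with y hy using (hc y hy).symm
    have hc0 : c = 0 := tendsto_nhds_unique hlim' hlim
    refine hne n hnN (funext fun y => ?_)
    by_cases hy : y ∈ ωs
    · rw [hc y hy, hc0]; rfl
    · exact VhOn.eq_zero (h.mem_Wh hnN).1.1 hy

end IsEigensystem

end MSGFEM

/-! ### Harmonic part of the fine-scale solution and Céa's lemma. -/

namespace MSGFEM

variable {d M : ℕ} {Ω ΓD : Set (E d)} {A : E d → Matrix (Fin d) (Fin d) ℝ} {α β C₁ : ℝ}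
  {T : Set (Element d)} {f q : E d → ℝ} {g : (E d → ℝ) → ℝ}

theorem load_eq_of_eq_zero_outside {ω : Set (E d)} (hΩ : IsOpen Ω) (hωΩ : ω ⊆ Ω) {v : E d → ℝ}
    (h0 : ∀ x, x ∉ ω → v x = 0) : load f g Ω v = load f g ω v := by
  rw [load, load, setIntegral_eq_of_subset_of_forall_sdiff_eq_zero hΩ.measurableSet hωΩ
    fun x hx => by rw [h0 x hx.2, mul_zero]]

/-- The restriction of the fine-scale solution minus the local particular function is discretely
`A`-harmonic. -/
theorem IsFineSolution.sub_mem_Wh {ω : Set (E d)} {u ψr ψd : E d → ℝ} (hΩ : IsOpen Ω)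
    (hb : Bornology.IsBounded Ω) (hΓD : ΓD ⊆ frontier Ω) (hT : IsMesh Ω T)
    (hA : IsCoefficient Ω A α β) (hω : IsOpen ω) (hωΩ : ω ⊆ Ω) (hres : Resolves T ω)
    (hu : IsFineSolution Ω ΓD A f g q T u) (hr : IsLocalRhsPart Ω ΓD A f g T ω ψr)
    (hd : IsLocalDirichletPart Ω ΓD A q T ω ψd) :
    ω.indicator u - ψr - ψd ∈ Wh Ω ΓD A T ω := by
  have hmem : ω.indicator u ∈ VhOn Ω T ω := ⟨u, hu.mem, rfl⟩
  have hH1 : ∀ {v}, v ∈ VhOn Ω T ω → v ∈ H1 ω := fun hv =>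
    (VhOn.boundedLip hΩ hT hω hωΩ hv).mem_H1 hω (hb.subset hωΩ)
  have hbω := hb.subset hωΩ
  have hAω := hA.mono hωΩ
  refine ⟨⟨VhOn.sub (VhOn.sub hmem hr.mem.1) hd.mem, fun x hx => ?_⟩, fun v hv => ?_⟩
  · have h1 : Tendsto (ω.indicator u) (𝓝[ω] x) (𝓝 (q x)) := by
      refine ((hu.boundary x hx.2).mono_left (nhdsWithin_mono _ hωΩ)).congr' ?_
      filter_upwards [self_mem_nhdsWithin] with z hz
      exact (indicator_of_mem hz u).symm
    have h2 : Tendsto ψr (𝓝[ω] x) (𝓝 0) := hr.mem.2 x (Or.inl hx)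
    have h3 := (h1.sub h2).sub (hd.boundary x hx)
    rw [sub_zero, sub_self] at h3
    exact h3
  · have hv0 : ∀ x, x ∉ ω → v x = 0 := fun x hx => VhOn.eq_zero hv.1 hx
    -- Extended by zero, `v` is an admissible test function for the fine-scale problem on `Ω`.
    have hvV := VhDI.mem_Vh hΩ hT hω hωΩ hres hv
    have h1 : energy A Ω u v = load f g Ω v := hu.weak v hvV fun x hx =>
      (VhD.tendsto_zero hΩ hω hωΩ hΓD (VhD_of_VhDI hv) hx).mono_left nhdsWithin_le_nhds
    rw [energy_eq_of_eq_zero_outside hΩ hb hT hω hωΩ hres (Vh.boundedLip hΩ hT hu.mem)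
      (Vh.boundedLip hΩ hT hvV) hv0, load_eq_of_eq_zero_outside hΩ hωΩ hv0] at h1
    rw [energy_sub_left hω hbω hAω (H1.sub hbω (hH1 hmem) (hH1 hr.mem.1)) (hH1 hd.mem) (hH1 hv.1),
      energy_sub_left hω hbω hAω (hH1 hmem) (hH1 hr.mem.1) (hH1 hv.1), hr.weak v hv,
      hd.weak v (VhD_of_VhDI hv), energy_congr hω eqOn_indicator (eqOn_refl v ω), h1]
    ring

/-- Pythagoras: `z` is orthogonal to `ψr` because `z` is in `W_h`, and to `ψd` because `ψd` is
orthogonal to all of `V_{h,D}`, which contains `z`. -/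
theorem IsFineSolution.energy_sub_le {ω : Set (E d)} {u ψr ψd : E d → ℝ} (hΩ : IsOpen Ω)
    (hb : Bornology.IsBounded Ω) (hΓD : ΓD ⊆ frontier Ω) (hT : IsMesh Ω T)
    (hA : IsCoefficient Ω A α β) (hω : IsOpen ω) (hωΩ : ω ⊆ Ω) (hres : Resolves T ω)
    (hu : IsFineSolution Ω ΓD A f g q T u) (hr : IsLocalRhsPart Ω ΓD A f g T ω ψr)
    (hd : IsLocalDirichletPart Ω ΓD A q T ω ψd) :
    energy A ω (ω.indicator u - ψr - ψd) (ω.indicator u - ψr - ψd) ≤ energy A ω u u := by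
  have hz := hu.sub_mem_Wh hΩ hb hΓD hT hA hω hωΩ hres hr hd
  set z := ω.indicator u - ψr - ψd with hzdef
  have hH1 : ∀ {v}, v ∈ VhOn Ω T ω → v ∈ H1 ω := fun hv =>
    (VhOn.boundedLip hΩ hT hω hωΩ hv).mem_H1 hω (hb.subset hωΩ)
  have hbω := hb.subset hωΩ
  have hAω := hA.mono hωΩ
  have hsplit : ω.indicator u = z + (ψr + ψd) := by rw [hzdef]; abel
  have hzH := hH1 hz.1.1
  have hrH := hH1 hr.mem.1
  have hdH := hH1 hd.mem
  have hsum := H1.add hbω hrH hdH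
  have h1 : energy A ω z (ψr + ψd) = 0 := by
    rw [energy_add_right hω hbω hAω hrH hdH hzH, hz.2 ψr hr.mem, energy_comm hAω,
      hd.weak z hz.1, add_zero]
  have h2 := energy_add_smul_self hω hbω hAω hzH hsum 1
  rw [one_smul, h1, ← hsplit, energy_congr hω eqOn_indicator eqOn_indicator] at h2
  rw [h2]
  linarith [energy_self_nonneg hAω (ψr + ψd)]

theorem globalSpace.sub_mem {ω : Fin M → Set (E d)} {χ : Fin M → E d → ℝ}
    {φ : Fin M → ℕ → E d → ℝ} {n : Fin M → ℕ} {u v : E d → ℝ} (hu : u ∈ globalSpace ω χ φ n)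
    (hv : v ∈ globalSpace ω χ φ n) : u - v ∈ globalSpace ω χ φ n := by
  obtain ⟨a, ha, rfl⟩ := hu
  obtain ⟨b, hb, rfl⟩ := hv
  refine ⟨a - b, fun i => Submodule.sub_mem _ (ha i) (hb i), ?_⟩
  rw [← Finset.sum_sub_distrib]
  exact Finset.sum_congr rfl fun i _ => (mul_sub _ _ _).symm

/-- Quasi-optimality of the Galerkin solution: Céa's lemma in the energy norm. -/
theorem IsGalerkinSolution.energyNorm_sub_le {S : Set (E d → ℝ)} {ue up uG w : E d → ℝ}
    (hΩ : IsOpen Ω) (hb : Bornology.IsBounded Ω) (hA : IsCoefficient Ω A α β)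
    (hue : IsWeakSolution Ω ΓD A f g q ue) (hS : S ⊆ H1Zero Ω ΓD)
    (hsub : ∀ u ∈ S, ∀ v ∈ S, u - v ∈ S) (hup : up ∈ H1 Ω)
    (huG : IsGalerkinSolution Ω A f g up S uG) (hw : w ∈ S) :
    energyNorm A Ω (ue - uG) ≤ energyNorm A Ω (ue - (up + w)) := by
  obtain ⟨us, hus, rfl, hweak⟩ := huG
  have hueH : ue ∈ H1 Ω := hue.trace.1
  have husH : us ∈ H1 Ω := (hS hus).1
  have hupus := H1.add hb hup husH
  have ht : us - w ∈ S := hsub us hus w hw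
  have htH : us - w ∈ H1 Ω := (hS ht).1
  -- Functions of `S` have zero trace on `ΓD`, so they test the exact equation as well as the
  -- Galerkin one.
  have horth : energy A Ω (ue - (up + us)) (us - w) = 0 := by
    rw [energy_sub_left hΩ hb hA hueH hupus htH, energy_add_left hΩ hb hA hup husH htH,
      hue.weak _ (hS ht), hweak _ ht]
    ring
  have h2 := energy_add_smul_self hΩ hb hA (H1.sub hb hueH hupus) htH 1
  rw [one_smul, horth] at h2
  have h3 : ue - (up + us) + (us - w) = ue - (up + w) := by abel
  rw [h3] at h2
  refine Real.sqrt_le_sqrt ?_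
  rw [h2]
  linarith [energy_self_nonneg hA (us - w)]

end MSGFEM

/-! ### The global error estimate. -/

open MSGFEM

theorem theorem3p3 {d M : ℕ} (hd : d = 2 ∨ d = 3)
    -- the domain, the two parts of its boundary, and the data of the problem
    (Ω ΓD ΓN : Set (E d)) (hΩ : IsLipschitzDomain Ω)
    (hΓD : IsBoundaryPart Ω ΓD) (hΓN : IsBoundaryPart Ω ΓN) (hΓ : ΓD ∩ ΓN = ∅)
    (hΓcover : closure ΓD ∪ closure ΓN = frontier Ω)
    (A : E d → Matrix (Fin d) (Fin d) ℝ) (α β : ℝ) (hA : IsCoefficient Ω A α β)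
    (f : E d → ℝ) (hf : MemLp f 2 (volume.restrict Ω))
    (g : (E d → ℝ) → ℝ) (hg : IsNeumannDatum Ω ΓN g) (q : E d → ℝ)
    -- the fine mesh
    (T : Set (Element d)) (hT : IsMesh Ω T)
    -- subdomains, oversampling domains resolved by the mesh, partition of unity
    (ω ωs : Fin M → Set (E d)) (χ : Fin M → E d → ℝ) (C₁ : ℝ)
    (hω : IsDecomposition Ω ω ωs χ C₁) (hres : ∀ i, Resolves T (ωs i))
    (κ κs : ℕ) (hκ : ∀ x ∈ Ω, {i | x ∈ ω i}.ncard ≤ κ)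
    (hκs : ∀ x ∈ Ω, {i | x ∈ ωs i}.ncard ≤ κs)
    -- local particular functions
    (ψr ψd : Fin M → E d → ℝ)
    (hψr : ∀ i, IsLocalRhsPart Ω ΓD A f g T (ωs i) (ψr i))
    (hψd : ∀ i, IsLocalDirichletPart Ω ΓD A q T (ωs i) (ψd i))
    -- local eigenpairs and dimensions of the local approximation spaces
    (N : Fin M → ℕ) (lam : Fin M → ℕ → ℝ≥0∞) (φ : Fin M → ℕ → E d → ℝ)
    (heig : ∀ i, IsEigensystem Ω ΓD A T (ω i) (ωs i) (χ i) (N i) (lam i) (φ i))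
    (n : Fin M → ℕ) (hn : ∀ i, n i ≤ N i)
    (hn_pos : ∀ i, frontier (ωs i) ∩ ΓD = ∅ → 1 ≤ n i)
    -- exact solution, fine-scale solution, discrete MS-GFEM solution
    (ue ueh uGh : E d → ℝ)
    (hue : IsWeakSolution Ω ΓD A f g q ue)
    (hueh : IsFineSolution Ω ΓD A f g q T ueh)
    (huGh : IsGalerkinSolution Ω A f g (globalParticular ω χ fun i => ψr i + ψd i)
      (globalSpace ω χ φ n) uGh) :
    uGh ∈ H1 Ω ∧
    ENNReal.ofReal (energyNorm A Ω (ue - uGh)) ≤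
      ENNReal.ofReal (energyNorm A Ω (ue - ueh)) +
        ENNReal.ofReal (Real.sqrt ((κ : ℝ) * (κs : ℝ))) *
          (⨆ i, (lam i (n i)) ^ (-(1 / 2) : ℝ)) *
          ENNReal.ofReal (energyNorm A Ω ueh) := by
  have hO := hΩ.isOpen
  have hb := hΩ.isBounded
  have hΓsub : ΓD ⊆ frontier Ω := by
    obtain ⟨U, -, rfl⟩ := hΓD
    exact inter_subset_right
  have hpos : ∀ i, 0 < lam i (n i) := fun i => (heig i).pos hO hb hT hA (hω.isOpen_over i)
    (hω.isConnected_over i) (hω.over_subset i) (hres i) (hn_pos i)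
  set S := globalSpace ω χ φ n with hSdef
  set up := globalParticular ω χ fun i => ψr i + ψd i with hup
  have hS : S ⊆ H1Zero Ω ΓD := by
    rintro _ ⟨w, hw, rfl⟩
    choose v hv hvw using fun i => mem_localSpace_iff.1 (hw i)
    have := hω.sum_mem_H1Zero hO hb hT hΓD fun i => ((heig i).span_subset_Wh (hn i) (hv i)).1
    simpa only [hvw] using this
  have hψ : ∀ i, ψr i + ψd i ∈ VhOn Ω T (ωs i) := fun i => VhOn.add (hψr i).mem.1 (hψd i).mem
  have hupH : up ∈ H1 Ω := BoundedLip.mem_H1 hO hb <|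
    BoundedLip.sum _ fun i _ => hω.boundedLip_mul_indicator hO hT i (hψ i)
  refine ⟨?_, ?_⟩
  · obtain ⟨us, hus, rfl, -⟩ := huGh
    exact H1.add hb hupH (hS hus).1
  have hueL := Vh.boundedLip hO hT hueh.mem
  let z : Fin M → E d → ℝ := fun i => (ωs i).indicator ueh - ψr i - ψd i
  have hzW : ∀ i, z i ∈ Wh Ω ΓD A T (ωs i) := fun i =>
    hueh.sub_mem_Wh hO hb hΓsub hT hA (hω.isOpen_over i) (hω.over_subset i) (hres i) (hψr i)
      (hψd i)
  choose v hv hvle using fun i => (heig i).exists_approx hO hb hT hA (hω.isOpen i)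
    (hω.isOpen_over i) (hω.subset_over i) (hω.over_subset i)
    ((hω.boundedLip hO i).mono (hω.subset i)) (hpos i) (hzW i)
  have hvW := fun i => (heig i).span_subset_Wh (hn i) (hv i)
  set w : E d → ℝ := ∑ i, χ i * (ω i).indicator (v i) with hw
  have hwS : w ∈ S := ⟨fun i => (ω i).indicator (v i),
    fun i => mem_localSpace_iff.2 ⟨v i, hv i, rfl⟩, rfl⟩
  let e : Fin M → E d → ℝ := fun i => χ i * (ω i).indicator (z i - v i)
  have hzv : ∀ i, z i - v i ∈ VhOn Ω T (ωs i) := fun i => VhOn.sub (hzW i).1.1 (hvW i).1.1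
  -- Writing `ueh = ∑ χ i * ueh` makes the error of the candidate a sum of local errors.
  have herr : EqOn (ueh - (up + w)) (∑ i, e i) Ω := by
    intro x hx
    have h1 : ueh x = ∑ i, χ i x * ueh x := by
      rw [← Finset.sum_mul, hω.sum_eq_one x hx, one_mul]
    simp only [Pi.sub_apply, Pi.add_apply, hup, hw, globalParticular, Finset.sum_apply]
    rw [h1, ← Finset.sum_add_distrib, ← Finset.sum_sub_distrib]
    refine Finset.sum_congr rfl fun i _ => ?_
    by_cases hxi : x ∈ ω i
    · simp only [e, z, Pi.mul_apply, indicator_of_mem hxi, Pi.sub_apply, Pi.add_apply,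
        indicator_of_mem (hω.subset_over i hxi)]
      ring
    · simp [e, hω.eq_zero i x ⟨hx, hxi⟩]
  -- The estimate is proved in `ℝ`. Nothing is lost with `toReal`: positivity of the eigenvalues
  -- makes this supremum over finitely many indices finite.
  set s : ℝ := (⨆ i, (lam i (n i)) ^ (-(1 / 2) : ℝ)).toReal with hs
  have hrpow : ∀ i, (lam i (n i)) ^ (-(1 / 2) : ℝ) ≠ ∞ := fun i h =>
    (hpos i).ne' (by
      rcases ENNReal.rpow_eq_top_iff.1 h with h | h
      · exact h.1
      · exact absurd h.2 (by norm_num))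
  have hsup : (⨆ i, (lam i (n i)) ^ (-(1 / 2) : ℝ)) ≠ ∞ := by
    refine ne_top_of_le_ne_top (ENNReal.sum_ne_top.2 fun i _ => hrpow i)
      (iSup_le fun i => Finset.single_le_sum (f := fun i => (lam i (n i)) ^ (-(1 / 2) : ℝ))
        (fun _ _ => bot_le) (Finset.mem_univ i))
  have hlam : ∀ i, ((lam i (n i))⁻¹).toReal ≤ s ^ 2 := by
    intro i
    have h1 : (lam i (n i))⁻¹ = ((lam i (n i)) ^ (-(1 / 2) : ℝ)) ^ (2 : ℕ) := by
      rw [← ENNReal.rpow_natCast, ← ENNReal.rpow_mul, ← ENNReal.rpow_neg_one]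
      norm_num
    rw [h1, ENNReal.toReal_pow]
    exact pow_le_pow_left₀ ENNReal.toReal_nonneg
      (ENNReal.toReal_mono hsup (le_iSup (fun i => (lam i (n i)) ^ (-(1 / 2) : ℝ)) i)) 2
  have hloc : ∀ i, energy A (ω i) (e i) (e i) ≤ s ^ 2 * energy A (ωs i) ueh ueh := by
    intro i
    have hei : EqOn (e i) (χ i * (z i - v i)) (ω i) := fun x hx => by
      simp [e, indicator_of_mem hx]
    rw [energy_congr (hω.isOpen i) hei hei]
    exact (hvle i).trans (mul_le_mul (hlam i)
      (hueh.energy_sub_le hO hb hΓsub hT hA (hω.isOpen_over i) (hω.over_subset i) (hres i)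
        (hψr i) (hψd i)) (energy_self_nonneg (hA.mono (hω.over_subset i)) _) (sq_nonneg s))
  have hen : energy A Ω (ueh - (up + w)) (ueh - (up + w)) ≤
      κ * κs * s ^ 2 * energy A Ω ueh ueh := by
    rw [energy_congr hO herr herr]
    calc energy A Ω (∑ i, e i) (∑ i, e i) ≤ κ * ∑ i, energy A (ω i) (e i) (e i) :=
          energy_sum_le hO hb hA hω.isOpen hω.subset hκ
            (fun i => hω.boundedLip_mul_indicator hO hT i (hzv i))
            (fun i => hω.ae_gradient_mul_indicator_eq_zero hO hT i (hzv i))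
      _ ≤ κ * ∑ i, s ^ 2 * energy A (ωs i) ueh ueh := by
          gcongr with i
          exact hloc i
      _ = κ * (s ^ 2 * ∑ i, energy A (ωs i) ueh ueh) := by rw [← Finset.mul_sum]
      _ ≤ κ * (s ^ 2 * (κs * energy A Ω ueh ueh)) := by
          gcongr
          exact sum_energy_le hO hb hA hω.isOpen_over hω.over_subset hκs hueL
      _ = _ := by ring
  have hs0 : 0 ≤ s := ENNReal.toReal_nonneg
  have hnorm : energyNorm A Ω (ueh - (up + w)) ≤
      Real.sqrt (κ * κs) * s * energyNorm A Ω ueh := by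
    refine (Real.sqrt_le_sqrt hen).trans_eq ?_
    rw [Real.sqrt_mul (by positivity), Real.sqrt_mul (by positivity), Real.sqrt_sq hs0]
    rfl
  have huehH := hueL.mem_H1 hO hb
  have hfinal : energyNorm A Ω (ue - uGh) ≤
      energyNorm A Ω (ue - ueh) + Real.sqrt (κ * κs) * s * energyNorm A Ω ueh := by
    refine (huGh.energyNorm_sub_le hO hb hA hue hS (fun _ hu _ hv => globalSpace.sub_mem hu hv)
      hupH hwS).trans ?_
    have htri := energyNorm_add_le hO hb hA (H1.sub hb hue.trace.1 huehH)
      (H1.sub hb huehH (H1.add hb hupH (hS hwS).1))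
    rw [sub_add_sub_cancel] at htri
    linarith
  have hE : ∀ u, 0 ≤ energyNorm A Ω u := fun u => Real.sqrt_nonneg _
  rw [← ENNReal.ofReal_toReal hsup, ← ENNReal.ofReal_mul (Real.sqrt_nonneg _),
    ← ENNReal.ofReal_mul (by positivity), ← ENNReal.ofReal_add (hE _)
      (mul_nonneg (by positivity) (hE _))]
  exact ENNReal.ofReal_le_ofReal hfinal
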